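/- Let $\mathrm{Sp}(2)=\{g\in M_2(\mathbb H): g^*g=1\}$, let $\mathrm{Sph}\cong \mathrm{Sp}(1)\times \mathrm{Sp}(1)$ be its subgroup of diagonal matrices, and let $S^4\simeq\mathbb{HP}^1=\mathrm{Sph}\backslash \mathrm{Sp}(2)$, with $\mathrm{Sp}(2)$ acting by right translations. The coset of a matrix with lower row $(c,d)$, $c\neq 0$, has the coordinate $v=c^{-1}d=v_1+v_2i+v_3j+v_4k$; this identifies the big Bruhat cell with $\mathbb H$. Put $\rho=|v|$. For $v\ne0$ let $\Theta$ be the $\mathrm{Sp}(1)$-invariant $3$-vector field on $S^3=\mathrm{Sp}(1)$ with the value $i\wedge j\wedge k$ at $1$ (that is, $\Theta(u)=ui\wedge uj\wedge uk$), carried to the sphere of radius $\rho$ by $u\mapsto\rho u$. (In the coordinates $v=\rho\, e^{\theta_1 i}e^{\theta_2 j}e^{\theta_3 k}$, $\rho>0$, one has $\partial_\rho\wedge\partial_{\theta_1}\wedge\partial_{\theta_2}\wedge\partial_{\theta_3}=\cos(2\theta_2)\,\partial_\rho\wedge\Theta$, so that the two agree at $v = \rho$, where all $\theta_i=0$.)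 An invariant quatrisson structure on $\mathbb{HP}^1$ is a smooth $4$-vector field $\chi$ with $i_\chi\psi=1$ for some $\mathrm{Sp}(2)$-invariant volume form $\psi$. Let $\Lambda=E\wedge S_i\wedge S_j\wedge S_k\in\bigwedge^4\mathfrak{sp}(2)$, where $E=\begin{pmatrix}0&1\\-1&0\end{pmatrix}$ and $S_x=\begin{pmatrix}0&x\\x&0\end{pmatrix}$, and let $\Lambda^L$, $\Lambda^R$ be the left and right invariant $4$-vector fields on $\mathrm{Sp}(2)$ with the value $\Lambda$ at the identity. Then: 1. There is exactly one invariant quatrisson structure $\chi$ on $\mathbb{HP}^1$ whose value at $v=0$ is $\partial_{v_1}\wedge\partial_{v_2}\wedge\partial_{v_3}\wedge\partial_{v_4}$, and any two invariant quatrisson structures differ by a non-zero constant factor. 2. The field $\Lambda^L-\Lambda^R$ descends to a unique smooth $4$-vector field $\beta$ on $\mathbb{HP}^1$, and the value of $\beta$ at $v=0$ is $2\,\partial_{v_1}\wedge\partial_{v_2}\wedge\partial_{v_3}\wedge\partial_{v_4}$. Let $\aleph=\frac12\beta$ be the Bruhat quatrisson structure, normalized to have the value $\partial_{v_1}\wedge\partial_{v_2}\wedge\partial_{v_3}\wedge\partial_{v_4}$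 at $v=0$. 3. On the big cell, for $v\neq0$, $$\chi=\frac{(1+\rho^2)^4}{\rho^3}\,\partial_\rho\wedge\Theta,\qquad \aleph=\frac{(1+\rho^2)(1+3\rho^4)}{\rho^3}\,\partial_\rho\wedge\Theta,$$ and at every point of the big cell, $v=0$ included, $$\aleph=\frac{1+3\rho^4}{(1+\rho^2)^3}\,\chi.$$ -/

import Mathlib

open scoped Quaternion Manifold ContDiff

noncomputable section

namespace Quatrisson

open Matrix

/-! ### The group `Sp(2)`, its Lie algebra and the spheroid -/

/-- `2 × 2` matrices over the quaternions. -/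
abbrev Mat2 : Type := Matrix (Fin 2) (Fin 2) ℍ[ℝ]

/-- `Sp(2)`: the quaternionic matrices `g` with `g* g = 1` (and `g g* = 1`), `*` being the
conjugate transpose. It carries the topology of a subspace of the space of matrices. -/
abbrev Sp2 : Type := unitary Mat2

/-- The Lie algebra `sp(2) = {X | X + X* = 0}`, a real vector space. -/
def sp2 : Submodule ℝ Mat2 where
  carrier := {X | X + Xᴴ = 0}
  zero_mem' := by simp
  add_mem' := by
    intro X Y hX hY
    rw [Set.mem_ofPred_eq, conjTranspose_add, add_add_add_comm, hX, hY, add_zero]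
  smul_mem' := by
    intro c X hX
    have h : (c • X)ᴴ = c • Xᴴ := by
      ext1 i j
      simp [conjTranspose_apply]
    rw [Set.mem_ofPred_eq, h, ← smul_add, hX, smul_zero]

lemma mem_sp2 {X : Mat2} : X ∈ sp2 ↔ X + Xᴴ = 0 := Iff.rfl

/-- The spheroid `Sp(1) × Sp(1)`: the subgroup of diagonal matrices of `Sp(2)`. -/
def Sph : Subgroup Sp2 where
  carrier := {g | (g : Mat2).IsDiag}
  one_mem' := Matrix.isDiag_one
  mul_mem' := by
    intro a b ha hb
    rw [Set.mem_ofPred_eq, Matrix.isDiag_iff_diagonal_diag] at *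
    rw [Submonoid.coe_mul, ← ha, ← hb, diagonal_mul_diagonal]
    simp
  inv_mem' := by
    intro a ha
    exact Matrix.IsDiag.conjTranspose ha

lemma mem_Sph {g : Sp2} : g ∈ Sph ↔ (g : Mat2).IsDiag := Iff.rfl

/-! ### The quaternionic projective line `HP¹ = Sph \ Sp(2)` as a smooth manifold -/

/-- `HP¹ = Sph \ Sp(2)`, the space of cosets `Sph g`, with the quotient topology. -/
abbrev HP1 : Type := Quotient (QuotientGroup.rightRel Sph)

/-- The projection `Sp(2) → Sph \ Sp(2)`. -/
def proj (g : Sp2) : HP1 := Quotient.mk (QuotientGroup.rightRel Sph) g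

lemma proj_surjective : Function.Surjective proj := Quotient.mk_surjective

instance instContinuousConstSMulSph : ContinuousConstSMul Sph Sp2 :=
  ⟨fun _ => continuous_const.mul continuous_id⟩

lemma isOpenQuotientMap_proj : IsOpenQuotientMap proj :=
  MulAction.isOpenQuotientMap_quotientMk (Γ := Sph) (T := Sp2)

lemma proj_eq_iff {g h : Sp2} : proj g = proj h ↔ ∃ s ∈ Sph, s * g = h := by
  rw [proj, proj, Quotient.eq, QuotientGroup.rightRel_apply]
  constructor
  · intro H
    exact ⟨h * g⁻¹, H, by group⟩
  · rintro ⟨s, hs, rfl⟩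
    simpa using hs

lemma Sph_mul_apply {s : Sp2} (hs : s ∈ Sph) (g : Sp2) (j : Fin 2) :
    ((s * g : Sp2) : Mat2) 1 j = (s : Mat2) 1 1 * (g : Mat2) 1 j := by
  have h : (s : Mat2) 1 0 = 0 := hs (by decide)
  simp [Matrix.mul_apply, Fin.sum_univ_two, h]

lemma Sph_ne_zero {s : Sp2} (hs : s ∈ Sph) : (s : Mat2) 1 1 ≠ 0 := by
  intro h0
  have h : (s : Mat2) 1 0 = 0 := hs (by decide)
  have := congrArg (fun M : Mat2 => M 1 1) (Unitary.mul_star_self_of_mem s.2)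
  simp [Matrix.mul_apply, Fin.sum_univ_two, h, h0] at this

/-- The big Bruhat cell: the cosets of the matrices whose lower left entry is not zero. -/
def cell : Set HP1 := {x | ∃ g : Sp2, (g : Mat2) 1 0 ≠ 0 ∧ proj g = x}

lemma proj_mem_cell {g : Sp2} : proj g ∈ cell ↔ (g : Mat2) 1 0 ≠ 0 := by
  constructor
  · rintro ⟨h, hh, e⟩
    obtain ⟨s, hs, rfl⟩ := proj_eq_iff.1 e
    rw [Sph_mul_apply hs]
    exact mul_ne_zero (Sph_ne_zero hs) hh
  · exact fun h => ⟨g, h, rfl⟩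

/-- The coordinate of the big cell: the coset of a matrix with lower row `(c, d)`, `c ≠ 0`, has
the coordinate `v = c⁻¹ d`, so that its lower row is a left multiple of `(1, v)`. -/
def cellCoord : HP1 → ℍ[ℝ] :=
  Quotient.lift (fun g : Sp2 => ((g : Mat2) 1 0)⁻¹ * (g : Mat2) 1 1) (by
    intro a b h
    obtain ⟨s, hs, rfl⟩ := proj_eq_iff.1 (Quotient.sound h : proj a = proj b)
    rw [Sph_mul_apply hs, Sph_mul_apply hs, _root_.mul_inv_rev, mul_assoc,
      inv_mul_cancel_left₀ (Sph_ne_zero hs)])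

lemma cellCoord_proj (g : Sp2) :
    cellCoord (proj g) = ((g : Mat2) 1 0)⁻¹ * (g : Mat2) 1 1 := rfl

/-- The coset representative `k_v = (1 + |v|²)^(-1/2) (-v̄ 1; 1 v)`. -/
def cellRep (v : ℍ[ℝ]) : Sp2 :=
  ⟨(Real.sqrt (1 + ‖v‖ ^ 2))⁻¹ • !![-star v, 1; 1, v], by
    have hr : (Real.sqrt (1 + ‖v‖ ^ 2))⁻¹ * (Real.sqrt (1 + ‖v‖ ^ 2))⁻¹ * (1 + ‖v‖ ^ 2) = 1 := by
      have h : 0 < 1 + ‖v‖ ^ 2 := by positivity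
      rw [← mul_inv, Real.mul_self_sqrt h.le, inv_mul_cancel₀ h.ne']
    have hr' : (Real.sqrt (1 + ‖v‖ ^ 2))⁻¹ * ((Real.sqrt (1 + ‖v‖ ^ 2))⁻¹ * (1 + ‖v‖ * ‖v‖)) = 1 := by
      rw [← mul_assoc, ← sq, ← sq ‖v‖]; rw [sq]; exact hr
    have h1 : star v * v = ((‖v‖ * ‖v‖ : ℝ) : ℍ[ℝ]) := by
      rw [Quaternion.star_mul_self, Quaternion.normSq_eq_norm_mul_self]
    have h2 : v * star v = ((‖v‖ * ‖v‖ : ℝ) : ℍ[ℝ]) := by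
      rw [Quaternion.self_mul_star, Quaternion.normSq_eq_norm_mul_self]
    have key : ∀ r : ℝ, r * (r * (1 + ‖v‖ * ‖v‖)) = 1 →
        r • (r • ((1 : ℍ[ℝ]) + ((‖v‖ * ‖v‖ : ℝ) : ℍ[ℝ]))) = 1 := by
      intro r h
      have : (1 : ℍ[ℝ]) + ((‖v‖ * ‖v‖ : ℝ) : ℍ[ℝ]) = ((1 + ‖v‖ * ‖v‖ : ℝ) : ℍ[ℝ]) := by simp
      rw [this, ← Quaternion.coe_mul_eq_smul, ← Quaternion.coe_mul_eq_smul, ← Quaternion.coe_mul,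
        ← Quaternion.coe_mul, h, Quaternion.coe_one]
    have hk := key _ hr'
    rw [smul_add, smul_add] at hk
    rw [Unitary.mem_iff]
    constructor <;> ext1 i j <;> fin_cases i <;> fin_cases j <;>
      simp [Matrix.mul_apply, Fin.sum_univ_two, star_eq_conjTranspose, h1, h2] <;>
      simpa [add_comm] using hk⟩

/-- The point of `HP¹` with coordinate `v` in the big cell. -/
def cellPoint (v : ℍ[ℝ]) : HP1 := proj (cellRep v)

lemma cellRep_sqrt_ne (v : ℍ[ℝ]) : (Real.sqrt (1 + ‖v‖ ^ 2))⁻¹ ≠ 0 := by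
  have h : 0 < 1 + ‖v‖ ^ 2 := by positivity
  exact inv_ne_zero (Real.sqrt_ne_zero'.2 h)

lemma cellPoint_mem (v : ℍ[ℝ]) : cellPoint v ∈ cell := by
  refine proj_mem_cell.2 ?_
  simpa [cellRep] using cellRep_sqrt_ne v

lemma cellCoord_cellPoint (v : ℍ[ℝ]) : cellCoord (cellPoint v) = v := by
  rw [cellPoint, cellCoord_proj]
  have h := cellRep_sqrt_ne v
  have e : ∀ r : ℝ, r ≠ 0 → (r • (1 : ℍ[ℝ]))⁻¹ * (r • v) = v := by
    intro r hr
    have : r • v = (r • (1 : ℍ[ℝ])) * v := by simp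
    rw [this, inv_mul_cancel_left₀ (smul_ne_zero hr one_ne_zero)]
  simpa [cellRep] using e _ h

lemma continuous_entry (i j : Fin 2) : Continuous fun g : Sp2 => (g : Mat2) i j :=
  continuous_subtype_val.matrix_elem i j

lemma isOpen_cell : IsOpen cell := by
  rw [← isOpenQuotientMap_proj.isQuotientMap.isOpen_preimage]
  have : proj ⁻¹' cell = {g : Sp2 | (g : Mat2) 1 0 ≠ 0} := by
    ext g; exact proj_mem_cell
  rw [this]
  exact isOpen_ne_fun (continuous_entry 1 0) continuous_const

lemma continuousOn_cellCoord : ContinuousOn cellCoord cell := by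
  intro x hx
  obtain ⟨g, hg, rfl⟩ := hx
  refine ContinuousAt.continuousWithinAt ?_
  rw [← isOpenQuotientMap_proj.continuousAt_comp_iff]
  exact ((continuous_entry 1 0).continuousAt.inv₀ hg).mul (continuous_entry 1 1).continuousAt

lemma continuous_cellPoint : Continuous cellPoint := by
  refine isOpenQuotientMap_proj.continuous.comp (Continuous.subtype_mk ?_ _)
  have h : Continuous fun v : ℍ[ℝ] => (Real.sqrt (1 + ‖v‖ ^ 2))⁻¹ := by
    refine Continuous.inv₀ (by fun_prop) fun v => ?_
    have h : 0 < 1 + ‖v‖ ^ 2 := by positivity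
    exact Real.sqrt_ne_zero'.2 h
  refine h.smul ?_
  refine continuous_matrix fun i j => ?_
  fin_cases i <;> fin_cases j <;> simp <;> fun_prop

lemma cellPoint_cellCoord {x : HP1} (hx : x ∈ cell) : cellPoint (cellCoord x) = x := by
  obtain ⟨g, hg, rfl⟩ := hx
  set v := cellCoord (proj g) with hv
  have hv' : (g : Mat2) 1 1 = (g : Mat2) 1 0 * v := by
    rw [hv, cellCoord_proj, mul_inv_cancel_left₀ hg]
  have hd : (g : Mat2) 0 0 + (g : Mat2) 0 1 * star v = 0 := by
    have := congrArg (fun M : Mat2 => M 0 1) (Unitary.mul_star_self_of_mem g.2)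
    simp only [Matrix.mul_apply, Fin.sum_univ_two, star_eq_conjTranspose, conjTranspose_apply,
      hv', star_mul, ← mul_assoc] at this
    rw [← add_mul] at this
    simpa [hg] using this
  refine proj_eq_iff.2 ⟨g * (cellRep v)⁻¹, ?_, by group⟩
  have hc : ((g * (cellRep v)⁻¹ : Sp2) : Mat2) = (g : Mat2) * ((cellRep v : Sp2) : Mat2)ᴴ := rfl
  rw [mem_Sph, hc]
  have key : ∀ r : ℝ, ((g : Mat2) * (r • !![-star v, 1; 1, v])ᴴ).IsDiag := by
    intro r i j hij
    have e : (g : Mat2) 0 0 = -((g : Mat2) 0 1 * star v) := eq_neg_of_add_eq_zero_left hd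
    fin_cases i <;> fin_cases j <;>
      simp [Matrix.mul_apply, Fin.sum_univ_two, hv', e] at hij ⊢
  exact key _

/-- The action of `Sp(2)` on `HP¹ = Sph \ Sp(2)` by right translations, `Sph g ↦ Sph g h`. -/
def act (h : Sp2) : HP1 → HP1 :=
  Quotient.map (fun g : Sp2 => g * h) (by
    intro a b hab
    obtain ⟨s, hs, rfl⟩ := proj_eq_iff.1 (Quotient.sound hab : proj a = proj b)
    exact Quotient.exact (proj_eq_iff.2 ⟨s, hs, (mul_assoc s a h).symm⟩ :
      proj (a * h) = proj (s * a * h)))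

lemma act_proj (h g : Sp2) : act h (proj g) = proj (g * h) := rfl

lemma continuous_act (h : Sp2) : Continuous (act h) := by
  rw [isOpenQuotientMap_proj.isQuotientMap.continuous_iff]
  exact isOpenQuotientMap_proj.continuous.comp (continuous_id.mul continuous_const)

/-- The matrix `(0 1; 1 0)`. -/
def swap : Sp2 :=
  ⟨!![0, 1; 1, 0], by
    rw [Unitary.mem_iff]
    constructor <;> ext1 i j <;> fin_cases i <;> fin_cases j <;>
      simp [Matrix.mul_apply, Fin.sum_univ_two, star_eq_conjTranspose]⟩

lemma swap_mul_swap : swap * swap = 1 := by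
  refine Subtype.ext (?_ : (!![0, 1; 1, 0] * !![0, 1; 1, 0] : Mat2) = 1)
  ext1 i j
  fin_cases i <;> fin_cases j <;> simp [Matrix.mul_apply, Fin.sum_univ_two]

lemma mul_swap_apply (g : Sp2) (i : Fin 2) : ((g * swap : Sp2) : Mat2) i 0 = (g : Mat2) i 1 ∧
    ((g * swap : Sp2) : Mat2) i 1 = (g : Mat2) i 0 := by
  simp [Matrix.mul_apply, Fin.sum_univ_two, swap]

/-- Right translation by `(0 1; 1 0)`, that is `[c : d] ↦ [d : c]`, as a homeomorphism. -/
def swapHomeo : HP1 ≃ₜ HP1 where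
  toFun := act swap
  invFun := act swap
  left_inv := by
    intro x
    obtain ⟨g, rfl⟩ := proj_surjective x
    rw [act_proj, act_proj, mul_assoc, swap_mul_swap, mul_one]
  right_inv := by
    intro x
    obtain ⟨g, rfl⟩ := proj_surjective x
    rw [act_proj, act_proj, mul_assoc, swap_mul_swap, mul_one]
  continuous_toFun := continuous_act swap
  continuous_invFun := continuous_act swap

/-- The chart `v = c⁻¹ d` on the big cell `c ≠ 0`. -/
def chartCell : OpenPartialHomeomorph HP1 ℍ[ℝ] where
  toFun := cellCoord
  invFun := cellPoint
  source := cell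
  target := Set.univ
  map_source' := fun _ _ => Set.mem_univ _
  map_target' := fun v _ => cellPoint_mem v
  left_inv' := fun _ hx => cellPoint_cellCoord hx
  right_inv' := fun v _ => cellCoord_cellPoint v
  open_source := isOpen_cell
  open_target := isOpen_univ
  continuousOn_toFun := continuousOn_cellCoord
  continuousOn_invFun := continuous_cellPoint.continuousOn

/-- The chart `w = d⁻¹ c` on the set `d ≠ 0`, which contains the point `c = 0` outside the
big cell. -/
def chartInfty : OpenPartialHomeomorph HP1 ℍ[ℝ] :=
  swapHomeo.transOpenPartialHomeomorph chartCell

lemma mem_chartInfty_source (g : Sp2) : proj g ∈ chartInfty.source ↔ (g : Mat2) 1 1 ≠ 0 := by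
  change act swap (proj g) ∈ cell ↔ _
  rw [act_proj, proj_mem_cell, (mul_swap_apply g 1).1]

lemma chartInfty_proj (g : Sp2) :
    chartInfty (proj g) = ((g : Mat2) 1 1)⁻¹ * (g : Mat2) 1 0 := by
  change cellCoord (act swap (proj g)) = _
  rw [act_proj, cellCoord_proj, (mul_swap_apply g 1).1, (mul_swap_apply g 1).2]

lemma mem_chartInfty_of_not_mem_cell {x : HP1} (hx : x ∉ cell) : x ∈ chartInfty.source := by
  obtain ⟨g, rfl⟩ := proj_surjective x
  rw [mem_chartInfty_source]
  intro h1
  have h0 : (g : Mat2) 1 0 = 0 := by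
    by_contra h
    exact hx (proj_mem_cell.2 h)
  have := congrArg (fun M : Mat2 => M 1 1) (Unitary.mul_star_self_of_mem g.2)
  simp [Matrix.mul_apply, Fin.sum_univ_two, h1, h0] at this

open Classical in
/-- `HP¹` as a manifold with the two charts `v = c⁻¹ d` and `w = d⁻¹ c`. -/
instance instChartedSpaceHP1 : ChartedSpace ℍ[ℝ] HP1 where
  atlas := {chartCell, chartInfty}
  chartAt x := if x ∈ cell then chartCell else chartInfty
  mem_chart_source x := by
    split_ifs with h
    · exact h
    · exact mem_chartInfty_of_not_mem_cell h
  chart_mem_atlas x := by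
    split_ifs
    · exact Or.inl rfl
    · exact Or.inr rfl

lemma cellPoint_swap (v : ℍ[ℝ]) (hv : act swap (cellPoint v) ∈ cell) :
    v ≠ 0 ∧ cellCoord (act swap (cellPoint v)) = v⁻¹ := by
  rw [cellPoint, act_proj, proj_mem_cell, (mul_swap_apply _ 1).1] at hv
  have h := cellRep_sqrt_ne v
  have hv0 : v ≠ 0 := by
    rintro rfl
    simp [cellRep] at hv
  refine ⟨hv0, ?_⟩
  rw [cellPoint, act_proj, cellCoord_proj, (mul_swap_apply _ 1).1, (mul_swap_apply _ 1).2]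
  have e : ∀ r : ℝ, r ≠ 0 → (r • v)⁻¹ * (r • (1 : ℍ[ℝ])) = v⁻¹ := by
    intro r hr
    have : r • v = (r • (1 : ℍ[ℝ])) * v := by simp
    rw [this, _root_.mul_inv_rev, mul_assoc, inv_mul_cancel₀ (smul_ne_zero hr one_ne_zero), mul_one]
  simpa [cellRep] using e _ h

instance instIsManifoldHP1 : IsManifold 𝓘(ℝ, ℍ[ℝ]) ∞ HP1 := by
  refine isManifold_of_contDiffOn _ _ _ ?_
  have key : ∀ s : Set ℍ[ℝ], (∀ v ∈ s, act swap (cellPoint v) ∈ cell) →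
      ContDiffOn ℝ ∞ (fun v => cellCoord (act swap (cellPoint v))) s := by
    intro s hs
    refine ContDiffOn.congr (f := fun v => v⁻¹) ?_ fun v hv => (cellPoint_swap v (hs v hv)).2
    intro v hv
    have := contDiffAt_ringInverse ℝ (n := ∞) (Units.mk0 v (cellPoint_swap v (hs v hv)).1)
    rw [Ring.inverse_eq_inv'] at this
    exact this.contDiffWithinAt
  have key' : ∀ (s : Set ℍ[ℝ]) (f : ℍ[ℝ] → ℍ[ℝ]), (∀ v ∈ s, f v = v) → ContDiffOn ℝ ∞ f s :=
    fun s f h => contDiffOn_id.congr h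
  rintro e e' (rfl | rfl) (rfl | rfl)
  · refine key' _ _ ?_
    intro v hv
    exact cellCoord_cellPoint v
  · refine key _ ?_
    intro v hv
    exact hv.1.2
  · refine key _ ?_
    intro v hv
    exact hv.1.2
  · refine key' _ _ ?_
    intro v hv
    exact chartInfty.right_inv hv.1.1

/-! ### Four-vector fields and four-forms on `HP¹` -/

/-- The real basis `1, i, j, k` of the quaternions. -/
def quatBasis : Fin 4 → ℍ[ℝ] := ![1, ⟨0, 1, 0, 0⟩, ⟨0, 0, 1, 0⟩, ⟨0, 0, 0, 1⟩]

/-- A (not necessarily smooth) four-vector field on `HP¹`: a section of `⋀⁴ T HP¹`. -/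
abbrev FourVectorField : Type :=
  (x : HP1) → ⋀[ℝ]^4 (TangentSpace 𝓘(ℝ, ℍ[ℝ]) x)

/-- A (not necessarily smooth) four-form on `HP¹`. -/
abbrev FourForm : Type :=
  (x : HP1) → (TangentSpace 𝓘(ℝ, ℍ[ℝ]) x) [⋀^Fin 4]→ₗ[ℝ] ℝ

/-- The push-forward of four-vectors at the point `y` of `ℍ` by the parametrization `p` of a
part of `HP¹`. -/
def pushFour (p : ℍ[ℝ] → HP1) (y : ℍ[ℝ]) :
    ⋀[ℝ]^4 ℍ[ℝ] →ₗ[ℝ] ⋀[ℝ]^4 (TangentSpace 𝓘(ℝ, ℍ[ℝ]) (p y)) :=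
  exteriorPower.map 4
    (mfderiv 𝓘(ℝ, ℍ[ℝ]) 𝓘(ℝ, ℍ[ℝ]) p y : ℍ[ℝ] →L[ℝ] TangentSpace 𝓘(ℝ, ℍ[ℝ]) (p y)).toLinearMap

/-- `∂₁ ∧ ∂₂ ∧ ∂₃ ∧ ∂₄` on `ℍ`, in the coordinates `v = v₁ + v₂ i + v₃ j + v₄ k`. -/
def cartesianFour : ⋀[ℝ]^4 ℍ[ℝ] := exteriorPower.ιMulti ℝ 4 quatBasis

/-- A four-vector field is smooth if in each chart its coefficient with respect to
`∂₁ ∧ ∂₂ ∧ ∂₃ ∧ ∂₄` is smooth. -/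
def FourVectorField.IsSmooth (ξ : FourVectorField) : Prop :=
  ∀ e ∈ atlas ℍ[ℝ] HP1, ∃ f : ℍ[ℝ] → ℝ, ContDiffOn ℝ ∞ f e.target ∧
    ∀ y ∈ e.target, ξ (e.symm y) = f y • pushFour e.symm y cartesianFour

/-- A four-form is smooth if in each chart its coefficient, that is its value on
`(∂₁, ∂₂, ∂₃, ∂₄)`, is smooth. -/
def FourForm.IsSmooth (ψ : FourForm) : Prop :=
  ∀ e ∈ atlas ℍ[ℝ] HP1, ContDiffOn ℝ ∞
    (fun y => ψ (e.symm y) fun a =>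
      (mfderiv 𝓘(ℝ, ℍ[ℝ]) 𝓘(ℝ, ℍ[ℝ]) e.symm y :
        ℍ[ℝ] →L[ℝ] TangentSpace 𝓘(ℝ, ℍ[ℝ]) (e.symm y)) (quatBasis a)) e.target

/-- An `Sp(2)`-invariant volume form `ψ` on `HP¹`: smooth, nowhere zero, and equal to its
pull-back by each element of `Sp(2)`. (It is closed, as `HP¹` has dimension four.) -/
structure IsInvariantVolumeForm (ψ : FourForm) : Prop where
  smooth : ψ.IsSmooth
  ne_zero : ∀ x, ψ x ≠ 0
  invariant : ∀ (h : Sp2) (x : HP1),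
    (ψ (act h x)).compLinearMap
      (mfderiv 𝓘(ℝ, ℍ[ℝ]) 𝓘(ℝ, ℍ[ℝ]) (act h) x).toLinearMap = ψ x

/-- The invariant quatrisson structures on `HP¹`: the four-vector fields `χ` that correspond to
an `Sp(2)`-invariant volume form `ψ` by `i_χ ψ = 1`. (The form `ψ`, hence `χ`, is determined
only up to a non-zero constant. The condition `[χ, χ] = 0` is void here, since
`[χ, χ]` is a section of `⋀⁷ T HP¹ = 0`.) -/
def IsInvariantQuatrisson (χ : FourVectorField) : Prop :=
  χ.IsSmooth ∧ ∃ ψ : FourForm, IsInvariantVolumeForm ψ ∧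
    ∀ x, exteriorPower.alternatingMapLinearEquiv (ψ x) (χ x) = 1

/-! ### The four-vector field on `Sp(2)` and its push-forward -/

/-- The element `E = (0 1; -1 0)` of `sp(2)`. -/
def matE : sp2 :=
  ⟨!![0, 1; -1, 0], by
    rw [mem_sp2]
    ext1 i j
    fin_cases i <;> fin_cases j <;> simp⟩

/-- The element `S_x = (0 x; x 0)` of `sp(2)`, for a purely imaginary quaternion `x`. -/
def matS (x : ℍ[ℝ]) (hx : star x = -x) : sp2 :=
  ⟨!![0, x; x, 0], by
    rw [mem_sp2]
    ext1 i j
    fin_cases i <;> fin_cases j <;> simp [hx]⟩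

lemma star_quatBasis : star (quatBasis 1) = -quatBasis 1 ∧ star (quatBasis 2) = -quatBasis 2 ∧
    star (quatBasis 3) = -quatBasis 3 := by
  refine ⟨?_, ?_, ?_⟩ <;>
    ext <;> simp only [quatBasis, Quaternion.re_star, Quaternion.imI_star, Quaternion.imJ_star,
      Quaternion.imK_star, Quaternion.re_neg, Quaternion.imI_neg, Quaternion.imJ_neg,
      Quaternion.imK_neg] <;> simp

/-- `Λ = E ∧ S_i ∧ S_j ∧ S_k`. -/
def Lam : ⋀[ℝ]^4 sp2 :=
  exteriorPower.ιMulti ℝ 4 ![matE, matS (quatBasis 1) star_quatBasis.1,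
    matS (quatBasis 2) star_quatBasis.2.1, matS (quatBasis 3) star_quatBasis.2.2]

/-- `Ad(g⁻¹)`, that is `X ↦ g⁻¹ X g`, on `sp(2)`. -/
def AdInv (g : Sp2) : sp2 →ₗ[ℝ] sp2 where
  toFun X := ⟨((g⁻¹ : Sp2) : Mat2) * (X : Mat2) * (g : Mat2), by
    have h : ((g⁻¹ : Sp2) : Mat2) = (g : Mat2)ᴴ := rfl
    rw [mem_sp2, h, conjTranspose_mul, conjTranspose_mul, conjTranspose_conjTranspose,
      mul_assoc, ← mul_add, ← add_mul, mem_sp2.1 X.2, zero_mul, mul_zero]⟩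
  map_add' X Y := by
    ext1
    simp [mul_add, add_mul]
  map_smul' c X := by
    ext1
    simp

/-- The four-vector field `Λᴸ - Λᴿ` on `Sp(2)`, where each tangent space `T_g Sp(2)` is identified
with `sp(2)` by left translation. In this trivialization the left invariant field `Λᴸ` is
constant, and the right invariant field `Λᴿ` is `⋀⁴ Ad(g⁻¹) Λ` at `g`, as `X g = g (g⁻¹ X g)`. -/
def sham (g : Sp2) : ⋀[ℝ]^4 sp2 := Lam - exteriorPower.map 4 (AdInv g) Lam

lemma exp_mem_Sp2 (X : sp2) : NormedSpace.exp (X : Mat2) ∈ unitary Mat2 := by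
  have h : (X : Mat2)ᴴ = -(X : Mat2) := (neg_eq_of_add_eq_zero_right (mem_sp2.1 X.2)).symm
  let _ : NormedAlgebra ℚ ℍ[ℝ] := NormedAlgebra.restrictScalars ℚ ℝ ℍ[ℝ]
  have h1 : Commute (-(X : Mat2)) (X : Mat2) := (Commute.refl _).neg_left
  rw [Unitary.mem_iff, star_eq_conjTranspose, ← Matrix.exp_conjTranspose, h,
    ← Matrix.exp_add_of_commute _ _ h1, ← Matrix.exp_add_of_commute _ _ h1.symm,
    neg_add_cancel, add_neg_cancel, NormedSpace.exp_zero, and_self_iff]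

/-- `g exp X`, for `g` in `Sp(2)` and `X` in `sp(2)`. -/
def mulExp (g : Sp2) (X : sp2) : Sp2 := g * ⟨NormedSpace.exp (X : Mat2), exp_mem_Sp2 X⟩

section
open scoped Matrix.Norms.Operator

/-- The topology of `sp(2)` as a finite-dimensional normed space (it is the subspace topology). -/
abbrev sp2Topology : TopologicalSpace sp2 :=
  (inferInstance : NormedAddCommGroup sp2).toMetricSpace.toPseudoMetricSpace.toUniformSpace.toTopologicalSpace

attribute [local instance 2000] sp2Topology

/-- The differential at `g` of the projection `Sp(2) → HP¹`, where `T_g Sp(2)` is identified with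
`sp(2)` by left translation: the differential at `X = 0` of `X ↦ Sph g exp X`. -/
def dProj (g : Sp2) : sp2 →ₗ[ℝ] TangentSpace 𝓘(ℝ, ℍ[ℝ]) (proj g) :=
  (mfderiv 𝓘(ℝ, sp2) 𝓘(ℝ, ℍ[ℝ]) (fun X : sp2 => proj (mulExp g X)) 0 :
    sp2 →L[ℝ] TangentSpace 𝓘(ℝ, ℍ[ℝ]) (proj g)).toLinearMap

end

/-- `β` is the four-vector field on `HP¹ = Sph \ Sp(2)` to which `Λᴸ - Λᴿ` descends. -/
def IsBruhatQuatrisson (β : FourVectorField) : Prop :=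
  β.IsSmooth ∧ ∀ g : Sp2, β (proj g) = exteriorPower.map 4 (dProj g) (sham g)

/-! ### Polar coordinates on the big cell `ℍ` -/

/-- `∂_ρ ∧ Θ` at a point `v ≠ 0` of `ℍ`, where `ρ = |v|`. Here `∂_ρ = v / |v|`, and `Θ` is the
(bi-)invariant three-vector field on the unit sphere `Sp(1)` with the value `i ∧ j ∧ k` at `1`,
so that `Θ(u) = u i ∧ u j ∧ u k`, transported to the sphere of radius `ρ` by `u ↦ ρ u`. -/
def radialTheta (v : ℍ[ℝ]) : ⋀[ℝ]^4 ℍ[ℝ] :=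
  exteriorPower.ιMulti ℝ 4
    ![‖v‖⁻¹ • v, v * quatBasis 1, v * quatBasis 2, v * quatBasis 3]

/-- The polar coordinates `v = ρ exp(θ₁ i) exp(θ₂ j) exp(θ₃ k)`. -/
def polar (ρ θ₁ θ₂ θ₃ : ℝ) : ℍ[ℝ] :=
  ρ • (NormedSpace.exp (θ₁ • quatBasis 1) * NormedSpace.exp (θ₂ • quatBasis 2) *
    NormedSpace.exp (θ₃ • quatBasis 3))

/-- `∂_ρ ∧ ∂_θ₁ ∧ ∂_θ₂ ∧ ∂_θ₃` for the polar coordinates `(ρ, θ₁, θ₂, θ₃)`, at the point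
`polar ρ θ₁ θ₂ θ₃`. -/
def polarFour (ρ θ₁ θ₂ θ₃ : ℝ) : ⋀[ℝ]^4 ℍ[ℝ] :=
  exteriorPower.ιMulti ℝ 4
    ![deriv (fun t => polar t θ₁ θ₂ θ₃) ρ, deriv (fun t => polar ρ t θ₂ θ₃) θ₁,
      deriv (fun t => polar ρ θ₁ t θ₃) θ₂, deriv (fun t => polar ρ θ₁ θ₂ t) θ₃]

end Quatrisson

end

open scoped Quaternion
open Quatrisson

noncomputable section

namespace Quatrisson

open Matrix

/-! ### Determinants of quadruples of quaternions -/

/-! The top exterior power of a four-dimensional space is a line, so a four-vector field on `HP1` is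
one scalar function times the coordinate frame `frameFour`, and every claim reduces to a determinant
`quatDet` of four quaternions.

Let g have rows (a, b) and (c, d), with c ≠ 0 and v = c⁻¹d. A tangent vector whose lower row is (c',
d') projects to c⁻¹(d' - c'v) in the coordinate v (`dProj_cell`). For the left invariant frame gE,
gS_x this gives 1 + v² and x - vxv, with determinant (1 + ρ²)(1 - ρ²)³ (`map_dProj_Lam`). For the
right invariant frame Eg, S_x g it gives c⁻¹ε(b - av) with ε = -1, i, j, k. Since the rows of g are
orthonormal, |b - av| = |c|(1 + ρ²), and the determinant is -(1 + ρ²)⁴ (`map_dProj_AdInv_Lam`). Both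
determinants depend only on the coset, so both four-vectors descend.

Right translations carry the right invariant frame to itself (`mfderiv_act_rightFrame`) and act
transitively, and this frame projects to a frame at every point. An invariant form is therefore the
same thing as a constant value on it. This yields existence and uniqueness up to scale
(`IsInvariantQuatrisson.eq_smul`), and χ is the projection of -Λᴿ. For Λᴸ - Λᴿ the two determinants
combine to (1 + ρ²)((1 - ρ²)³ + (1 + ρ²)³) = 2(1 + ρ²)(1 + 3ρ⁴). Finally ∂_ρ ∧ Θ has determinant ρ³,
whence the denominators.

The one point c = 0 outside the cell is treated in the chart w = d⁻¹c. The change of chart v = w⁻¹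
has determinant |w|⁻⁸, which decides smoothness there. -/

lemma quatBasis_zero : quatBasis 0 = 1 := rfl

lemma quatBasis_components (a : Fin 4) : (quatBasis a).re = ![1, 0, 0, 0] a ∧
    (quatBasis a).imI = ![0, 1, 0, 0] a ∧ (quatBasis a).imJ = ![0, 0, 1, 0] a ∧
    (quatBasis a).imK = ![0, 0, 0, 1] a := by
  fin_cases a <;> exact ⟨rfl, rfl, rfl, rfl⟩

/-- The coordinates of a quaternion with respect to `1, i, j, k`. -/
def quatEquiv : ℍ[ℝ] ≃ₗ[ℝ] (Fin 4 → ℝ) where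
  toFun q := ![q.re, q.imI, q.imJ, q.imK]
  invFun a := ⟨a 0, a 1, a 2, a 3⟩
  map_add' p q := by ext i; fin_cases i <;> simp
  map_smul' c q := by ext i; fin_cases i <;> simp
  left_inv q := rfl
  right_inv a := by ext i; fin_cases i <;> rfl

lemma quatEquiv_apply (q : ℍ[ℝ]) : quatEquiv q = ![q.re, q.imI, q.imJ, q.imK] := rfl

/-- The basis `1, i, j, k` of the quaternions. -/
def basisQuat : Module.Basis (Fin 4) ℝ ℍ[ℝ] := Module.Basis.ofEquivFun quatEquiv

lemma coe_basisQuat : ⇑basisQuat = quatBasis := by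
  rw [basisQuat, Module.Basis.coe_ofEquivFun]
  funext i
  rw [LinearEquiv.symm_apply_eq]
  rw [quatEquiv_apply]
  ext j
  fin_cases i <;> fin_cases j <;> simp [quatBasis_components]

/-- The alternating form on `ℍ` with the value `1` on `(1, i, j, k)`. -/
def quatDet : ℍ[ℝ] [⋀^Fin 4]→ₗ[ℝ] ℝ := basisQuat.det

lemma quatDet_quatBasis : quatDet quatBasis = 1 := by
  rw [← coe_basisQuat, quatDet, Module.Basis.det_self]

lemma quatDet_apply (v : Fin 4 → ℍ[ℝ]) :
    quatDet v = Matrix.det !![(v 0).re, (v 1).re, (v 2).re, (v 3).re;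
      (v 0).imI, (v 1).imI, (v 2).imI, (v 3).imI;
      (v 0).imJ, (v 1).imJ, (v 2).imJ, (v 3).imJ;
      (v 0).imK, (v 1).imK, (v 2).imK, (v 3).imK] := by
  rw [quatDet, Module.Basis.det_apply]
  congr 1
  ext i j
  rw [Module.Basis.toMatrix_apply, basisQuat, Module.Basis.ofEquivFun_repr_apply]
  fin_cases i <;> fin_cases j <;> rfl

/-- Two alternating maps agree once they agree on injective families of basis vectors. Such families
are permutations of the basis, and both sides change by the sign. -/
lemma ιMulti_eq_quatDet_smul (v : Fin 4 → ℍ[ℝ]) :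
    exteriorPower.ιMulti ℝ 4 v = quatDet v • cartesianFour := by
  have h : (exteriorPower.ιMulti ℝ 4 : ℍ[ℝ] [⋀^Fin 4]→ₗ[ℝ] _) =
      (LinearMap.toSpanSingleton ℝ _ cartesianFour).compAlternatingMap quatDet := by
    refine Module.Basis.ext_alternating basisQuat ?_
    intro f hf
    obtain ⟨σ, rfl⟩ : ∃ σ : Equiv.Perm (Fin 4), f = σ :=
      ⟨Equiv.ofBijective f (Finite.injective_iff_bijective.1 hf), rfl⟩
    rw [coe_basisQuat]
    have h1 := AlternatingMap.map_perm (exteriorPower.ιMulti ℝ 4) quatBasis σ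
    have h2 := AlternatingMap.map_perm quatDet quatBasis σ
    rw [quatDet_quatBasis] at h2
    simp only [Function.comp_def] at h1 h2
    rw [h1, LinearMap.compAlternatingMap_apply, h2, LinearMap.toSpanSingleton_apply]
    rcases Int.units_eq_one_or (Equiv.Perm.sign σ) with h | h <;> simp [h, cartesianFour]
  rw [h]
  rfl

lemma map_ιMulti_eq_quatDet_smul {E : Type*} [AddCommGroup E] [Module ℝ E] (f : E →ₗ[ℝ] ℍ[ℝ])
    (v : Fin 4 → E) :
    exteriorPower.map 4 f (exteriorPower.ιMulti ℝ 4 v) = quatDet (f ∘ v) • cartesianFour := by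
  rw [exteriorPower.map_apply_ιMulti, ιMulti_eq_quatDet_smul]

lemma alternating_eq_smul_quatDet (ψ : ℍ[ℝ] [⋀^Fin 4]→ₗ[ℝ] ℝ) : ψ = ψ quatBasis • quatDet := by
  have := ψ.eq_smul_basis_det basisQuat
  rwa [coe_basisQuat] at this

lemma exists_eq_smul_cartesianFour (ξ : ⋀[ℝ]^4 ℍ[ℝ]) : ∃ c : ℝ, ξ = c • cartesianFour := by
  have h : ξ ∈ Submodule.span ℝ (Set.range (exteriorPower.ιMulti ℝ 4 (M := ℍ[ℝ]))) := by
    rw [exteriorPower.ιMulti_span]; trivial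
  induction h using Submodule.span_induction with
  | mem x hx =>
    obtain ⟨v, rfl⟩ := hx
    exact ⟨_, ιMulti_eq_quatDet_smul v⟩
  | zero => exact ⟨0, (zero_smul _ _).symm⟩
  | add x y _ _ hx hy =>
    obtain ⟨a, rfl⟩ := hx
    obtain ⟨b, rfl⟩ := hy
    exact ⟨a + b, (add_smul _ _ _).symm⟩
  | smul a x _ hx =>
    obtain ⟨b, rfl⟩ := hx
    exact ⟨a * b, smul_smul _ _ _⟩

lemma quatDet_comp (f : ℍ[ℝ] →ₗ[ℝ] ℍ[ℝ]) (v : Fin 4 → ℍ[ℝ]) :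
    quatDet (f ∘ v) = quatDet (f ∘ quatBasis) * quatDet v := by
  have h := alternating_eq_smul_quatDet (quatDet.compLinearMap f)
  exact congrArg (fun ψ : ℍ[ℝ] [⋀^Fin 4]→ₗ[ℝ] ℝ => ψ v) h

lemma sq_norm_eq (v : ℍ[ℝ]) : ‖v‖ ^ 2 = v.re ^ 2 + v.imI ^ 2 + v.imJ ^ 2 + v.imK ^ 2 := by
  rw [← Quaternion.normSq_def', Quaternion.normSq_eq_norm_mul_self, sq]

/-- Multiplication by a is |a| times an isometry of ℝ⁴ that preserves orientation; here its
determinant is expanded in components. -/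
lemma quatDet_mul_left (a : ℍ[ℝ]) (v : Fin 4 → ℍ[ℝ]) :
    quatDet (fun i => a * v i) = ‖a‖ ^ 4 * quatDet v := by
  have h := quatDet_comp (LinearMap.mulLeft ℝ a) v
  have h' : quatDet ((fun q => a * q) ∘ quatBasis) = ‖a‖ ^ 4 := by
    rw [quatDet_apply, show ‖a‖ ^ 4 = (‖a‖ ^ 2) ^ 2 by ring, sq_norm_eq]
    simp [quatBasis_components, Matrix.det_succ_row_zero, Fin.sum_univ_succ, Fin.succAbove]
    ring
  exact h.trans (congrArg (· * quatDet v) h')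

lemma quatDet_mul_right (a : ℍ[ℝ]) (v : Fin 4 → ℍ[ℝ]) :
    quatDet (fun i => v i * a) = ‖a‖ ^ 4 * quatDet v := by
  have h := quatDet_comp (LinearMap.mulRight ℝ a) v
  have h' : quatDet ((fun q => q * a) ∘ quatBasis) = ‖a‖ ^ 4 := by
    rw [quatDet_apply, show ‖a‖ ^ 4 = (‖a‖ ^ 2) ^ 2 by ring, sq_norm_eq]
    simp [quatBasis_components, Matrix.det_succ_row_zero, Fin.sum_univ_succ, Fin.succAbove]
    ring
  exact h.trans (congrArg (· * quatDet v) h')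

lemma quatDet_update_smul_one (c : ℝ) (a b d e : ℍ[ℝ]) :
    quatDet ![c • a, b, d, e] = c * quatDet ![a, b, d, e] := by
  have h := quatDet.map_update_smul ![a, b, d, e] 0 c a
  have h1 : ∀ q : ℍ[ℝ], Function.update ![a, b, d, e] 0 q = ![q, b, d, e] := by
    intro q
    funext i
    fin_cases i <;> rfl
  rwa [h1, h1, smul_eq_mul] at h

/-- Conjugation by a unit quaternion rotates i, j, k, so one may think of v in ℝ + ℝi. On that plane
the vectors 1 + v² and i(1 - v²) contribute 1 - ρ⁴. On its complement vjv = |v|²j and vkv = |v|²k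
contribute (1 - ρ²)². The proof expands the determinant directly. -/
lemma quatDet_left_frame (v : ℍ[ℝ]) :
    quatDet ![1 + v * v, quatBasis 1 - v * quatBasis 1 * v, quatBasis 2 - v * quatBasis 2 * v,
      quatBasis 3 - v * quatBasis 3 * v] = (1 + ‖v‖ ^ 2) * (1 - ‖v‖ ^ 2) ^ 3 := by
  rw [quatDet_apply, sq_norm_eq]
  simp [quatBasis_components, Matrix.det_succ_row_zero, Fin.sum_univ_succ, Fin.succAbove]
  ring

lemma quatDet_neg_one_frame :
    quatDet ![-1, quatBasis 1, quatBasis 2, quatBasis 3] = -1 := by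
  rw [quatDet_apply]
  simp [quatBasis_components, Matrix.det_succ_row_zero, Fin.sum_univ_succ, Fin.succAbove]

lemma quatDet_radial {v : ℍ[ℝ]} (hv : v ≠ 0) :
    quatDet ![‖v‖⁻¹ • v, v * quatBasis 1, v * quatBasis 2, v * quatBasis 3] = ‖v‖ ^ 3 := by
  rw [quatDet_update_smul_one]
  have h := quatDet_mul_left v quatBasis
  have e : (fun i => v * quatBasis i) =
      ![v, v * quatBasis 1, v * quatBasis 2, v * quatBasis 3] := by
    funext i
    fin_cases i <;> simp [quatBasis_zero]
  rw [e, quatDet_quatBasis] at h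
  rw [h]
  field_simp [norm_ne_zero_iff.2 hv]

lemma radialTheta_eq {v : ℍ[ℝ]} (hv : v ≠ 0) : radialTheta v = ‖v‖ ^ 3 • cartesianFour := by
  rw [radialTheta, ιMulti_eq_quatDet_smul, quatDet_radial hv]

/-! ### Derivatives in the charts of `HP¹` -/

/-- The tangent space at `x`, identified with `ℍ` by the preferred chart at `x`. -/
def tang (x : HP1) : ℍ[ℝ] ≃L[ℝ] TangentSpace 𝓘(ℝ, ℍ[ℝ]) x := ContinuousLinearEquiv.refl ℝ ℍ[ℝ]

lemma chartAt_of_mem_cell {x : HP1} (hx : x ∈ cell) : chartAt ℍ[ℝ] x = chartCell := if_pos hx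

lemma chartAt_of_notMem_cell {x : HP1} (hx : x ∉ cell) : chartAt ℍ[ℝ] x = chartInfty := if_neg hx

section
variable {E : Type*} [NormedAddCommGroup E] [NormedSpace ℝ E]

/-- The derivative into a manifold is by definition the derivative in the preferred chart at the
image point, so `tang`, the identity of ℍ, is all that has to be inserted. -/
lemma hasMFDerivAt_of_chart {f : E → HP1} {y : E} {D : E →L[ℝ] ℍ[ℝ]}
    {e : OpenPartialHomeomorph HP1 ℍ[ℝ]} (he : chartAt ℍ[ℝ] (f y) = e) (hf : ContinuousAt f y)
    (h : HasFDerivAt (fun z => e (f z)) D y) :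
    HasMFDerivAt 𝓘(ℝ, E) 𝓘(ℝ, ℍ[ℝ]) f y ((tang (f y)).toContinuousLinearMap ∘L D) := by
  subst he
  exact ⟨hf, h.hasFDerivWithinAt⟩

/-- The product rule for c⁻¹d, with derivative -c⁻¹c'c⁻¹ of the inverse. -/
lemma hasMFDerivAt_proj_cell {γ : E → Sp2} {y : E} {c' d' : E →L[ℝ] ℍ[ℝ]} (hγ : ContinuousAt γ y)
    (hy : (γ y : Mat2) 1 0 ≠ 0) (hc : HasFDerivAt (fun z => (γ z : Mat2) 1 0) c' y)
    (hd : HasFDerivAt (fun z => (γ z : Mat2) 1 1) d' y) :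
    ∃ D : E →L[ℝ] ℍ[ℝ], (∀ z, D z = ((γ y : Mat2) 1 0)⁻¹ *
      (d' z - c' z * (((γ y : Mat2) 1 0)⁻¹ * (γ y : Mat2) 1 1))) ∧
      HasMFDerivAt 𝓘(ℝ, E) 𝓘(ℝ, ℍ[ℝ]) (fun z => proj (γ z)) y
        ((tang (proj (γ y))).toContinuousLinearMap ∘L D) := by
  have hi := (hasFDerivAt_inv' (𝕜 := ℝ) hy).comp y hc
  have h := hi.mul' hd
  refine ⟨_, fun z => ?_, hasMFDerivAt_of_chart (chartAt_of_mem_cell (proj_mem_cell.2 hy))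
    (isOpenQuotientMap_proj.continuous.continuousAt.comp hγ) h⟩
  simp [mul_add, mul_assoc, sub_eq_add_neg]

/-- The product rule for d⁻¹c; the term that differentiates d⁻¹ carries the factor c = 0. -/
lemma hasMFDerivAt_proj_infty {γ : E → Sp2} {y : E} {c' d' : E →L[ℝ] ℍ[ℝ]} (hγ : ContinuousAt γ y)
    (hy : (γ y : Mat2) 1 0 = 0) (hc : HasFDerivAt (fun z => (γ z : Mat2) 1 0) c' y)
    (hd : HasFDerivAt (fun z => (γ z : Mat2) 1 1) d' y) :
    ∃ D : E →L[ℝ] ℍ[ℝ], (∀ z, D z = ((γ y : Mat2) 1 1)⁻¹ * c' z) ∧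
      HasMFDerivAt 𝓘(ℝ, E) 𝓘(ℝ, ℍ[ℝ]) (fun z => proj (γ z)) y
        ((tang (proj (γ y))).toContinuousLinearMap ∘L D) := by
  have hx : proj (γ y) ∉ cell := fun h => proj_mem_cell.1 h hy
  have hy1 : (γ y : Mat2) 1 1 ≠ 0 :=
    (mem_chartInfty_source _).1 (mem_chartInfty_of_not_mem_cell hx)
  have hi := (hasFDerivAt_inv' (𝕜 := ℝ) hy1).comp y hd
  have h := hi.mul' hc
  have h2 := h.congr_of_eventuallyEq (f₁ := fun z => chartInfty (proj (γ z)))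
    (.of_forall fun z => chartInfty_proj (γ z))
  refine ⟨_, fun z => ?_, hasMFDerivAt_of_chart (chartAt_of_notMem_cell hx)
    (isOpenQuotientMap_proj.continuous.continuousAt.comp hγ) h2⟩
  simp [hy]

lemma mdifferentiableAt_proj {γ : E → Sp2} {y : E} (hγ : ContinuousAt γ y)
    (h : ∀ j, DifferentiableAt ℝ (fun z => (γ z : Mat2) 1 j) y) :
    MDifferentiableAt 𝓘(ℝ, E) 𝓘(ℝ, ℍ[ℝ]) (fun z => proj (γ z)) y := by
  by_cases hy : (γ y : Mat2) 1 0 = 0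
  · obtain ⟨D, -, hD⟩ := hasMFDerivAt_proj_infty hγ hy (h 0).hasFDerivAt (h 1).hasFDerivAt
    exact hD.mdifferentiableAt
  · obtain ⟨D, -, hD⟩ := hasMFDerivAt_proj_cell hγ hy (h 0).hasFDerivAt (h 1).hasFDerivAt
    exact hD.mdifferentiableAt

end

/-! ### The parametrizations of the two charts -/

lemma hasMFDerivAt_cellPoint (v : ℍ[ℝ]) :
    HasMFDerivAt 𝓘(ℝ, ℍ[ℝ]) 𝓘(ℝ, ℍ[ℝ]) cellPoint v
      ((tang (cellPoint v)).toContinuousLinearMap ∘L ContinuousLinearMap.id ℝ ℍ[ℝ]) := by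
  refine hasMFDerivAt_of_chart (chartAt_of_mem_cell (cellPoint_mem v))
    continuous_cellPoint.continuousAt ?_
  exact (hasFDerivAt_id v).congr_of_eventuallyEq (.of_forall fun z => cellCoord_cellPoint z)

lemma chartInfty_symm_apply (w : ℍ[ℝ]) : chartInfty.symm w = act swap (cellPoint w) := rfl

lemma chartInfty_symm_mem_cell {w : ℍ[ℝ]} : chartInfty.symm w ∈ cell ↔ w ≠ 0 := by
  rw [chartInfty_symm_apply, cellPoint, act_proj, proj_mem_cell, (mul_swap_apply _ 1).1]
  have h := cellRep_sqrt_ne w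
  simp only [cellRep, Matrix.smul_apply, Matrix.of_apply, Matrix.cons_val_one, Matrix.cons_val_fin_one]
  exact smul_ne_zero_iff.trans (and_iff_right h)

lemma cellCoord_chartInfty_symm {w : ℍ[ℝ]} (hw : w ≠ 0) : cellCoord (chartInfty.symm w) = w⁻¹ :=
  (cellPoint_swap w (chartInfty_symm_mem_cell.2 hw)).2

lemma continuous_chartInfty_symm : Continuous chartInfty.symm :=
  (continuous_act swap).comp continuous_cellPoint

lemma hasMFDerivAt_chartInfty_symm_zero :
    HasMFDerivAt 𝓘(ℝ, ℍ[ℝ]) 𝓘(ℝ, ℍ[ℝ]) chartInfty.symm (0 : ℍ[ℝ])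
      ((tang (chartInfty.symm 0)).toContinuousLinearMap ∘L ContinuousLinearMap.id ℝ ℍ[ℝ]) := by
  refine hasMFDerivAt_of_chart
    (chartAt_of_notMem_cell fun h => chartInfty_symm_mem_cell.1 h rfl)
    continuous_chartInfty_symm.continuousAt ?_
  exact (hasFDerivAt_id _).congr_of_eventuallyEq
    (.of_forall fun z => chartInfty.right_inv (Set.mem_univ z))

/-- Away from w = 0 the preferred chart at the image is v, not w, so the derivative is that of w ↦
w⁻¹. -/
lemma hasMFDerivAt_chartInfty_symm {w : ℍ[ℝ]} (hw : w ≠ 0) :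
    HasMFDerivAt 𝓘(ℝ, ℍ[ℝ]) 𝓘(ℝ, ℍ[ℝ]) chartInfty.symm w
      ((tang (chartInfty.symm w)).toContinuousLinearMap ∘L
        (-ContinuousLinearMap.mulLeftRight ℝ ℍ[ℝ] w⁻¹ w⁻¹)) := by
  refine hasMFDerivAt_of_chart (chartAt_of_mem_cell (chartInfty_symm_mem_cell.2 hw))
    continuous_chartInfty_symm.continuousAt ?_
  refine (hasFDerivAt_inv' hw).congr_of_eventuallyEq ?_
  filter_upwards [isOpen_ne.mem_nhds hw] with z hz using cellCoord_chartInfty_symm hz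

/-- `∂₁ ∧ ∂₂ ∧ ∂₃ ∧ ∂₄` at `x`, in the preferred chart at `x`. -/
def frameFour (x : HP1) : ⋀[ℝ]^4 (TangentSpace 𝓘(ℝ, ℍ[ℝ]) x) :=
  exteriorPower.map 4 (tang x).toLinearEquiv.toLinearMap cartesianFour

lemma map_tang_comp {E : Type*} [AddCommGroup E] [Module ℝ E] (x : HP1) (f : E →ₗ[ℝ] ℍ[ℝ])
    (v : Fin 4 → E) :
    exteriorPower.map 4 ((tang x).toLinearEquiv.toLinearMap ∘ₗ f) (exteriorPower.ιMulti ℝ 4 v) =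
      quatDet (f ∘ v) • frameFour x := by
  rw [exteriorPower.map_comp, LinearMap.comp_apply, map_ιMulti_eq_quatDet_smul, map_smul, frameFour]

lemma pushFour_of_hasMFDerivAt {p : ℍ[ℝ] → HP1} {y : ℍ[ℝ]} {D : ℍ[ℝ] →L[ℝ] ℍ[ℝ]}
    (h : HasMFDerivAt 𝓘(ℝ, ℍ[ℝ]) 𝓘(ℝ, ℍ[ℝ]) p y ((tang (p y)).toContinuousLinearMap ∘L D)) :
    pushFour p y cartesianFour = quatDet (D ∘ quatBasis) • frameFour (p y) := by
  have e : pushFour p y = exteriorPower.map 4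
      ((tang (p y)).toLinearEquiv.toLinearMap ∘ₗ D.toLinearMap) := by
    unfold pushFour
    rw [h.mfderiv]
    rfl
  rw [e]
  exact map_tang_comp _ _ _

lemma pushFour_cellPoint (v : ℍ[ℝ]) :
    pushFour cellPoint v cartesianFour = frameFour (cellPoint v) := by
  rw [pushFour_of_hasMFDerivAt (hasMFDerivAt_cellPoint v), ContinuousLinearMap.coe_id',
    Function.id_comp, quatDet_quatBasis, one_smul]

lemma pushFour_chartInfty_symm_zero :
    pushFour chartInfty.symm 0 cartesianFour = frameFour (chartInfty.symm 0) := by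
  rw [pushFour_of_hasMFDerivAt hasMFDerivAt_chartInfty_symm_zero, ContinuousLinearMap.coe_id',
    Function.id_comp, quatDet_quatBasis, one_smul]

lemma quatDet_neg_mulLeftRight (w : ℍ[ℝ]) :
    quatDet ((-ContinuousLinearMap.mulLeftRight ℝ ℍ[ℝ] w w : ℍ[ℝ] →L[ℝ] ℍ[ℝ]) ∘ quatBasis) =
      ‖w‖ ^ 8 := by
  have e : (-ContinuousLinearMap.mulLeftRight ℝ ℍ[ℝ] w w : ℍ[ℝ] →L[ℝ] ℍ[ℝ]) ∘ quatBasis =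
      fun i => (-w) * (quatBasis i * w) := by
    funext i
    simp [mul_assoc]
  rw [e, quatDet_mul_left, quatDet_mul_right, quatDet_quatBasis, norm_neg]
  ring

lemma pushFour_chartInfty_symm {w : ℍ[ℝ]} (hw : w ≠ 0) :
    pushFour chartInfty.symm w cartesianFour =
      ‖w⁻¹‖ ^ 8 • frameFour (chartInfty.symm w) := by
  rw [pushFour_of_hasMFDerivAt (hasMFDerivAt_chartInfty_symm hw), quatDet_neg_mulLeftRight]

lemma exists_eq_smul_frameFour {x : HP1} (ξ : ⋀[ℝ]^4 (TangentSpace 𝓘(ℝ, ℍ[ℝ]) x)) :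
    ∃ c : ℝ, ξ = c • frameFour x := by
  obtain ⟨c, hc⟩ := exists_eq_smul_cartesianFour
    (exteriorPower.map 4 (tang x).symm.toLinearEquiv.toLinearMap ξ)
  refine ⟨c, ?_⟩
  have h := congrArg (exteriorPower.map 4 (tang x).toLinearEquiv.toLinearMap) hc
  rw [map_smul, ← LinearMap.comp_apply, ← exteriorPower.map_comp] at h
  have e : (tang x).toLinearEquiv.toLinearMap ∘ₗ (tang x).symm.toLinearEquiv.toLinearMap =
      LinearMap.id := by
    ext q
    exact (tang x).apply_symm_apply q
  rwa [e, exteriorPower.map_id] at h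

/-! ### The differential of the projection and of the action -/

section
open scoped Matrix.Norms.Operator
attribute [local instance 2000] sp2Topology

/-- The linear map `X ↦ (g X)_{ij}`. -/
def mulEntry (g : Sp2) (i j : Fin 2) : Mat2 →L[ℝ] ℍ[ℝ] :=
  LinearMap.toContinuousLinearMap
    { toFun := fun X => ((g : Mat2) * X) i j
      map_add' := fun X Y => by rw [mul_add, Matrix.add_apply]
      map_smul' := fun c X => by rw [mul_smul_comm, Matrix.smul_apply, RingHom.id_apply] }

lemma hasFDerivAt_mulExp (g : Sp2) (i j : Fin 2) :
    HasFDerivAt (fun X : sp2 => (mulExp g X : Mat2) i j) (mulEntry g i j ∘L sp2.subtypeL) 0 := by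
  have h0 : HasFDerivAt (NormedSpace.exp : Mat2 → Mat2) (1 : Mat2 →L[ℝ] Mat2)
      (sp2.subtypeL 0) := by
    rw [map_zero]; exact hasFDerivAt_exp_zero
  have h1 := h0.comp (0 : sp2) sp2.subtypeL.hasFDerivAt
  exact (mulEntry g i j).hasFDerivAt.comp (0 : sp2) h1

lemma mulExp_zero (g : Sp2) : mulExp g 0 = g := by
  refine Subtype.ext ?_
  change (g : Mat2) * NormedSpace.exp (0 : Mat2) = g
  rw [NormedSpace.exp_zero, mul_one]

lemma continuousAt_mulExp (g : Sp2) : ContinuousAt (mulExp g) (0 : sp2) := by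
  have h : ContinuousAt (fun X : sp2 => ((g : Mat2) * NormedSpace.exp (X : Mat2))) 0 := by
    have h0 : ContinuousAt (NormedSpace.exp : Mat2 → Mat2) (sp2.subtypeL 0) := by
      rw [map_zero]
      exact (hasFDerivAt_exp_zero (𝕂 := ℝ)).continuousAt
    exact continuousAt_const.mul (h0.comp sp2.subtypeL.continuous.continuousAt)
  exact Topology.IsInducing.subtypeVal.continuousAt_iff.2 h

lemma dProj_eq_of_hasMFDerivAt {g : Sp2} {D : sp2 →L[ℝ] ℍ[ℝ]}
    (h : HasMFDerivAt 𝓘(ℝ, sp2) 𝓘(ℝ, ℍ[ℝ]) (fun X : sp2 => proj (mulExp g X)) 0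
      ((tang (proj (mulExp g 0))).toContinuousLinearMap ∘L D)) :
    dProj g = (tang (proj g)).toLinearEquiv.toLinearMap ∘ₗ D.toLinearMap := by
  unfold dProj
  rw [h.mfderiv]
  rfl

lemma dProj_cell {g : Sp2} (hg : (g : Mat2) 1 0 ≠ 0) :
    ∃ D : sp2 →ₗ[ℝ] ℍ[ℝ], (∀ X : sp2, D X = ((g : Mat2) 1 0)⁻¹ *
      (((g : Mat2) * X) 1 1 - ((g : Mat2) * X) 1 0 * (((g : Mat2) 1 0)⁻¹ * (g : Mat2) 1 1))) ∧
      dProj g = (tang (proj g)).toLinearEquiv.toLinearMap ∘ₗ D := by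
  obtain ⟨D, hD, h⟩ := hasMFDerivAt_proj_cell (continuousAt_mulExp g) (by rwa [mulExp_zero])
    (hasFDerivAt_mulExp g 1 0) (hasFDerivAt_mulExp g 1 1)
  refine ⟨D.toLinearMap, fun X => ?_, dProj_eq_of_hasMFDerivAt h⟩
  have h1 := hD X
  rw [mulExp_zero] at h1
  exact h1

lemma dProj_infty {g : Sp2} (hg : (g : Mat2) 1 0 = 0) :
    ∃ D : sp2 →ₗ[ℝ] ℍ[ℝ], (∀ X : sp2, D X = ((g : Mat2) 1 1)⁻¹ * ((g : Mat2) * X) 1 0) ∧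
      dProj g = (tang (proj g)).toLinearEquiv.toLinearMap ∘ₗ D := by
  obtain ⟨D, hD, h⟩ := hasMFDerivAt_proj_infty (continuousAt_mulExp g) (by rwa [mulExp_zero])
    (hasFDerivAt_mulExp g 1 0) (hasFDerivAt_mulExp g 1 1)
  refine ⟨D.toLinearMap, fun X => ?_, dProj_eq_of_hasMFDerivAt h⟩
  have h1 := hD X
  rw [mulExp_zero] at h1
  exact h1

lemma mdifferentiableAt_proj_mulExp (g : Sp2) :
    MDifferentiableAt 𝓘(ℝ, sp2) 𝓘(ℝ, ℍ[ℝ]) (fun X : sp2 => proj (mulExp g X)) 0 := by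
  refine mdifferentiableAt_proj (continuousAt_mulExp g) fun j => ?_
  exact (hasFDerivAt_mulExp g 1 j).differentiableAt

lemma continuous_cellRep : Continuous cellRep := by
  refine Continuous.subtype_mk ?_ _
  have h : Continuous fun v : ℍ[ℝ] => (Real.sqrt (1 + ‖v‖ ^ 2))⁻¹ := by
    refine Continuous.inv₀ (by fun_prop) fun v => ?_
    have h : 0 < 1 + ‖v‖ ^ 2 := by positivity
    exact Real.sqrt_ne_zero'.2 h
  refine h.smul ?_
  refine continuous_matrix fun i j => ?_
  fin_cases i <;> fin_cases j <;> simp <;> fun_prop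

lemma cellRep_mul_apply (v : ℍ[ℝ]) (g : Sp2) (j : Fin 2) :
    ((cellRep v * g : Sp2) : Mat2) 1 j =
      (Real.sqrt (1 + ‖v‖ ^ 2))⁻¹ • ((g : Mat2) 0 j + v * (g : Mat2) 1 j) := by
  simp [cellRep, Matrix.mul_apply, Fin.sum_univ_two]

lemma mdifferentiableAt_proj_cellRep_mul (g : Sp2) (v : ℍ[ℝ]) :
    MDifferentiableAt 𝓘(ℝ, ℍ[ℝ]) 𝓘(ℝ, ℍ[ℝ]) (fun v => proj (cellRep v * g)) v := by
  refine mdifferentiableAt_proj (continuous_cellRep.mul continuous_const).continuousAt fun j => ?_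
  simp only [cellRep_mul_apply]
  have h : 0 < 1 + ‖v‖ ^ 2 := by positivity
  have h1 : DifferentiableAt ℝ (fun v : ℍ[ℝ] => 1 + ‖v‖ ^ 2) v :=
    (differentiableAt_const _).add (differentiableAt_id.norm_sq ℝ)
  exact ((h1.sqrt h.ne').inv (Real.sqrt_ne_zero'.2 h)).smul
    ((differentiableAt_const _).add (differentiableAt_id.mul_const _))

/-- Near x the action is the chart followed by w ↦ `proj (cellRep w * s * h)`, where s is 1 for the
chart v and `swap` for the chart w. -/
lemma mdifferentiableAt_act (h : Sp2) (x : HP1) :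
    MDifferentiableAt 𝓘(ℝ, ℍ[ℝ]) 𝓘(ℝ, ℍ[ℝ]) (act h) x := by
  have key : ∀ (e : OpenPartialHomeomorph HP1 ℍ[ℝ]) (s : Sp2), e ∈ atlas ℍ[ℝ] HP1 → x ∈ e.source →
      (∀ w, e.symm w = proj (cellRep w * s)) →
      MDifferentiableAt 𝓘(ℝ, ℍ[ℝ]) 𝓘(ℝ, ℍ[ℝ]) (act h) x := by
    intro e s he hx hs
    have h1 := (mdifferentiableAt_proj_cellRep_mul (s * h) (e x)).comp x
      (mdifferentiableAt_atlas (I := 𝓘(ℝ, ℍ[ℝ])) he hx)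
    refine h1.congr_of_eventuallyEq ?_
    filter_upwards [e.open_source.mem_nhds hx] with z hz
    rw [Function.comp_apply, ← mul_assoc, ← act_proj, ← hs, e.left_inv hz]
  by_cases hx : x ∈ cell
  · exact key chartCell 1 (Or.inl rfl) hx fun w => by rw [mul_one]; rfl
  · exact key chartInfty swap (Or.inr rfl) (mem_chartInfty_of_not_mem_cell hx) fun w => rfl

lemma mulExp_mul (g h : Sp2) (X : sp2) : mulExp g X * h = mulExp (g * h) (AdInv h X) := by
  refine Subtype.ext ?_
  let _ : NormedAlgebra ℚ ℍ[ℝ] := NormedAlgebra.restrictScalars ℚ ℝ ℍ[ℝ]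
  have h1 := Matrix.exp_units_conj' (Unitary.toUnits h) (X : Mat2)
  change (g : Mat2) * NormedSpace.exp (X : Mat2) * (h : Mat2) =
    (g : Mat2) * (h : Mat2) * NormedSpace.exp (((h⁻¹ : Sp2) : Mat2) * X * (h : Mat2))
  have h2 : ((h : Mat2) * ((h⁻¹ : Sp2) : Mat2)) = 1 := Unitary.mul_star_self_of_mem h.2
  have h3 : NormedSpace.exp (((h⁻¹ : Sp2) : Mat2) * X * (h : Mat2)) =
      ((h⁻¹ : Sp2) : Mat2) * NormedSpace.exp (X : Mat2) * (h : Mat2) := h1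
  rw [h3, mul_assoc (g : Mat2) (h : Mat2), ← mul_assoc (h : Mat2), ← mul_assoc (h : Mat2), h2,
    one_mul, ← mul_assoc]

/-- Differentiate g exp(X) h = gh exp(h⁻¹Xh) at X = 0, after projection, by the chain rule on both
sides. -/
lemma mfderiv_act_dProj (h g : Sp2) (X : sp2) :
    mfderiv 𝓘(ℝ, ℍ[ℝ]) 𝓘(ℝ, ℍ[ℝ]) (act h) (proj g) (dProj g X) =
      dProj (g * h) (AdInv h X) := by
  have e : act h ∘ (fun X : sp2 => proj (mulExp g X)) =
      (fun X : sp2 => proj (mulExp (g * h) X)) ∘ (AdInv h).toContinuousLinearMap := by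
    funext Y
    exact congrArg proj (mulExp_mul g h Y)
  have h1 := mfderiv_comp_apply_of_eq (I := 𝓘(ℝ, sp2)) (x := (0 : sp2))
    (mdifferentiableAt_act h (proj g)) (mdifferentiableAt_proj_mulExp g)
    (by rw [mulExp_zero]) X
  have h2 := mfderiv_comp_apply_of_eq (I := 𝓘(ℝ, sp2)) (x := (0 : sp2))
    (mdifferentiableAt_proj_mulExp (g * h))
    (AdInv h).toContinuousLinearMap.differentiableAt.mdifferentiableAt
    (map_zero (AdInv h).toContinuousLinearMap) X
  rw [ContinuousLinearMap.mfderiv_eq] at h2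
  rw [e] at h1
  exact h1.symm.trans h2

end

/-! ### The projections of the left and right invariant fields -/

/-- The vectors `E, S_i, S_j, S_k`. -/
def lamBasis : Fin 4 → sp2 :=
  ![matE, matS (quatBasis 1) star_quatBasis.1, matS (quatBasis 2) star_quatBasis.2.1,
    matS (quatBasis 3) star_quatBasis.2.2]

lemma Lam_eq : Lam = exteriorPower.ιMulti ℝ 4 lamBasis := rfl

lemma mul_AdInv (g : Sp2) (X : sp2) : (g : Mat2) * (AdInv g X : Mat2) = (X : Mat2) * (g : Mat2) := by
  have h2 : ((g : Mat2) * ((g⁻¹ : Sp2) : Mat2)) = 1 := Unitary.mul_star_self_of_mem g.2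
  change (g : Mat2) * (((g⁻¹ : Sp2) : Mat2) * (X : Mat2) * (g : Mat2)) = _
  rw [← mul_assoc, ← mul_assoc, h2, one_mul]

lemma AdInv_AdInv (g h : Sp2) (X : sp2) : AdInv h (AdInv g X) = AdInv (g * h) X := by
  refine Subtype.ext ?_
  have e : (((g * h)⁻¹ : Sp2) : Mat2) = ((h⁻¹ : Sp2) : Mat2) * ((g⁻¹ : Sp2) : Mat2) := by
    rw [_root_.mul_inv_rev]; rfl
  change ((h⁻¹ : Sp2) : Mat2) * (((g⁻¹ : Sp2) : Mat2) * (X : Mat2) * (g : Mat2)) * (h : Mat2) =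
    (((g * h)⁻¹ : Sp2) : Mat2) * (X : Mat2) * ((g : Mat2) * (h : Mat2))
  rw [e]
  simp only [mul_assoc]

lemma mul_matE (g : Mat2) : (g * (matE : Mat2)) 1 0 = -g 1 1 ∧ (g * (matE : Mat2)) 1 1 = g 1 0 := by
  simp [matE, Matrix.mul_apply, Fin.sum_univ_two]

lemma mul_matS (g : Mat2) (x : ℍ[ℝ]) (hx : star x = -x) :
    (g * (matS x hx : Mat2)) 1 0 = g 1 1 * x ∧ (g * (matS x hx : Mat2)) 1 1 = g 1 0 * x := by
  simp [matS, Matrix.mul_apply, Fin.sum_univ_two]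

lemma matE_mul (g : Mat2) (j : Fin 2) : ((matE : Mat2) * g) 1 j = -1 * g 0 j := by
  simp [matE, Matrix.mul_apply, Fin.sum_univ_two]

lemma matS_mul (g : Mat2) (x : ℍ[ℝ]) (hx : star x = -x) (j : Fin 2) :
    ((matS x hx : Mat2) * g) 1 j = x * g 0 j := by
  simp [matS, Matrix.mul_apply, Fin.sum_univ_two]

lemma lamBasis_mul (g : Mat2) (a : Fin 4) (j : Fin 2) :
    ((lamBasis a : Mat2) * g) 1 j =
      (![-1, quatBasis 1, quatBasis 2, quatBasis 3] : Fin 4 → ℍ[ℝ]) a * g 0 j := by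
  fin_cases a
  · exact matE_mul g j
  · exact matS_mul g _ star_quatBasis.1 j
  · exact matS_mul g _ star_quatBasis.2.1 j
  · exact matS_mul g _ star_quatBasis.2.2 j

lemma sq_norm_row (g : Sp2) (i : Fin 2) : ‖(g : Mat2) i 0‖ ^ 2 + ‖(g : Mat2) i 1‖ ^ 2 = 1 := by
  have h := congrArg (fun M : Mat2 => M i i) (Unitary.mul_star_self_of_mem g.2)
  simp only [Matrix.mul_apply, Fin.sum_univ_two, star_eq_conjTranspose, conjTranspose_apply,
    Quaternion.self_mul_star, Matrix.one_apply_eq, Quaternion.normSq_eq_norm_mul_self] at h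
  rw [← Quaternion.coe_add, ← Quaternion.coe_one] at h
  rw [sq, sq]
  exact Quaternion.coe_injective h

lemma row_orthogonal (g : Sp2) : (g : Mat2) 0 0 * star ((g : Mat2) 1 0) +
    (g : Mat2) 0 1 * star ((g : Mat2) 1 1) = 0 := by
  have h := congrArg (fun M : Mat2 => M 0 1) (Unitary.mul_star_self_of_mem g.2)
  simpa [Matrix.mul_apply, Fin.sum_univ_two, star_eq_conjTranspose] using h

open Classical in
/-- The coefficient of the projection of `Λᴸ`, in the preferred chart at each point. -/
def leftCoeff (x : HP1) : ℝ :=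
  if x ∈ cell then (1 + ‖cellCoord x‖ ^ 2) * (1 - ‖cellCoord x‖ ^ 2) ^ 3 else -1

open Classical in
/-- Minus the coefficient of the projection of `Λᴿ`, in the preferred chart at each point. -/
def rightCoeff (x : HP1) : ℝ := if x ∈ cell then (1 + ‖cellCoord x‖ ^ 2) ^ 4 else 1

lemma rightCoeff_pos (x : HP1) : 0 < rightCoeff x := by
  unfold rightCoeff
  split_ifs <;> positivity

/-- The lower rows of gE and gS_x are (-d, c) and (dx, cx). After left multiplication by c⁻¹ only v
remains; at c = 0, multiplication by d⁻¹ leaves -1, i, j, k. -/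
lemma map_dProj_Lam (g : Sp2) :
    exteriorPower.map 4 (dProj g) Lam = leftCoeff (proj g) • frameFour (proj g) := by
  by_cases hg : (g : Mat2) 1 0 = 0
  · have hx : proj g ∉ cell := fun h => proj_mem_cell.1 h hg
    have hd : (g : Mat2) 1 1 ≠ 0 :=
      (mem_chartInfty_source _).1 (mem_chartInfty_of_not_mem_cell hx)
    obtain ⟨D, hD, h⟩ := dProj_infty hg
    rw [h, Lam_eq, map_tang_comp, leftCoeff, if_neg hx]
    congr 1
    rw [← quatDet_neg_one_frame]
    congr 1
    funext a
    rw [Function.comp_apply, hD]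
    fin_cases a
    · exact (congrArg _ (mul_matE _).1).trans (by simp [hd])
    · exact (congrArg _ (mul_matS _ _ star_quatBasis.1).1).trans (inv_mul_cancel_left₀ hd _)
    · exact (congrArg _ (mul_matS _ _ star_quatBasis.2.1).1).trans (inv_mul_cancel_left₀ hd _)
    · exact (congrArg _ (mul_matS _ _ star_quatBasis.2.2).1).trans (inv_mul_cancel_left₀ hd _)
  · obtain ⟨D, hD, h⟩ := dProj_cell hg
    have hS : ∀ (x : ℍ[ℝ]) (hx : star x = -x), ((g : Mat2) 1 0)⁻¹ *
        (((g : Mat2) * (matS x hx : Mat2)) 1 1 - ((g : Mat2) * (matS x hx : Mat2)) 1 0 *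
          (((g : Mat2) 1 0)⁻¹ * (g : Mat2) 1 1)) =
        x - ((g : Mat2) 1 0)⁻¹ * (g : Mat2) 1 1 * x * (((g : Mat2) 1 0)⁻¹ * (g : Mat2) 1 1) := by
      intro x hx
      rw [(mul_matS _ _ _).1, (mul_matS _ _ _).2]
      simp [mul_sub, hg, mul_assoc]
    rw [h, Lam_eq, map_tang_comp, leftCoeff, if_pos (proj_mem_cell.2 hg), ← quatDet_left_frame]
    congr 2
    funext a
    rw [Function.comp_apply, hD, cellCoord_proj]
    fin_cases a
    · change _ * (((g : Mat2) * (matE : Mat2)) 1 1 - ((g : Mat2) * (matE : Mat2)) 1 0 * _) = 1 + _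
      rw [(mul_matE _).1, (mul_matE _).2]
      simp [mul_add, hg, mul_assoc]
    · exact hS _ star_quatBasis.1
    · exact hS _ star_quatBasis.2.1
    · exact hS _ star_quatBasis.2.2

/-- In either chart the right invariant frame projects to vectors of this shape, so only the norms
of p and q matter. -/
lemma quatDet_lamBasis_conj (p q : ℍ[ℝ]) :
    quatDet (fun a => p * ((![-1, quatBasis 1, quatBasis 2, quatBasis 3] : Fin 4 → ℍ[ℝ]) a * q)) =
      -(‖p‖ * ‖q‖) ^ 4 := by
  rw [quatDet_mul_left, quatDet_mul_right, quatDet_neg_one_frame]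
  ring

/-- Applied to the unit rows (-b v̄, b) and (c, cv) of a matrix of `Sp2`, with n = |v|: it gives |b|
= |c|. -/
lemma eq_of_sq_mul_add_sq {b c n : ℝ} (hb : 0 ≤ b) (hc : 0 ≤ c) (h : (b * n) ^ 2 + b ^ 2 = 1)
    (h' : c ^ 2 + (c * n) ^ 2 = 1) : b = c := by
  rw [← sq_eq_sq₀ hb hc]
  have hp : 1 + n ^ 2 ≠ 0 := by positivity
  refine mul_right_cancel₀ hp ?_
  linear_combination h - h'

lemma norm_sub_neg_mul (b v : ℍ[ℝ]) : ‖b - -(b * star v) * v‖ = ‖b‖ * (1 + ‖v‖ ^ 2) := by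
  have hn : b - -(b * star v) * v = b * ((1 + ‖v‖ ^ 2 : ℝ) : ℍ[ℝ]) := by
    rw [neg_mul, mul_assoc, Quaternion.star_mul_self, Quaternion.normSq_eq_norm_mul_self,
      ← sq, sub_neg_eq_add, Quaternion.coe_add, mul_add, Quaternion.coe_one, mul_one]
  have hp : 0 ≤ 1 + ‖v‖ ^ 2 := by positivity
  rw [hn, norm_mul, Quaternion.norm_coe, Real.norm_of_nonneg hp]

lemma map_dProj_AdInv_Lam_infty {g : Sp2} (hg : (g : Mat2) 1 0 = 0) :
    exteriorPower.map 4 (dProj g) (exteriorPower.map 4 (AdInv g) Lam) =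
      -rightCoeff (proj g) • frameFour (proj g) := by
  rw [Lam_eq, exteriorPower.map_apply_ιMulti]
  have r0 := sq_norm_row g 0
  have r1 := sq_norm_row g 1
  have ro := row_orthogonal g
  have hx : proj g ∉ cell := fun h => proj_mem_cell.1 h hg
  have hd : (g : Mat2) 1 1 ≠ 0 :=
    (mem_chartInfty_source _).1 (mem_chartInfty_of_not_mem_cell hx)
  have hb : (g : Mat2) 0 1 = 0 := by simpa [hg, hd] using ro
  obtain ⟨D, hD, h⟩ := dProj_infty hg
  rw [h, map_tang_comp, rightCoeff, if_neg hx]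
  congr 1
  have e : D ∘ (AdInv g ∘ lamBasis) = fun a => ((g : Mat2) 1 1)⁻¹ *
      ((![-1, quatBasis 1, quatBasis 2, quatBasis 3] : Fin 4 → ℍ[ℝ]) a * (g : Mat2) 0 0) := by
    funext a
    rw [Function.comp_apply, hD, Function.comp_apply, mul_AdInv, lamBasis_mul]
  rw [e, quatDet_lamBasis_conj, norm_inv]
  rw [hb, norm_zero] at r0
  rw [hg, norm_zero] at r1
  have h0 : ‖(g : Mat2) 0 0‖ = 1 := by
    rw [← sq_eq_sq₀ (norm_nonneg _) zero_le_one]; linarith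
  have h1 : ‖(g : Mat2) 1 1‖ = 1 := by
    rw [← sq_eq_sq₀ (norm_nonneg _) zero_le_one]; linarith
  rw [h0, h1]
  norm_num

lemma map_dProj_AdInv_Lam_cell {g : Sp2} (hg : (g : Mat2) 1 0 ≠ 0) :
    exteriorPower.map 4 (dProj g) (exteriorPower.map 4 (AdInv g) Lam) =
      -rightCoeff (proj g) • frameFour (proj g) := by
  rw [Lam_eq, exteriorPower.map_apply_ιMulti]
  have r0 := sq_norm_row g 0
  have r1 := sq_norm_row g 1
  have ro := row_orthogonal g
  obtain ⟨D, hD, h⟩ := dProj_cell hg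
  rw [h, map_tang_comp, rightCoeff, if_pos (proj_mem_cell.2 hg), cellCoord_proj]
  congr 1
  set v := ((g : Mat2) 1 0)⁻¹ * (g : Mat2) 1 1 with hv
  have hdv : (g : Mat2) 1 1 = (g : Mat2) 1 0 * v := by rw [hv, mul_inv_cancel_left₀ hg]
  -- Orthogonality of the rows reads (a + b v̄) c̄ = 0, and c̄ ≠ 0 cancels.
  have ha : (g : Mat2) 0 0 = -((g : Mat2) 0 1 * star v) := by
    rw [hdv, star_mul, ← mul_assoc, ← add_mul] at ro
    exact eq_neg_of_add_eq_zero_left ((mul_eq_zero.1 ro).resolve_right (by simpa using hg))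
  have e : D ∘ (AdInv g ∘ lamBasis) = fun a => ((g : Mat2) 1 0)⁻¹ *
      ((![-1, quatBasis 1, quatBasis 2, quatBasis 3] : Fin 4 → ℍ[ℝ]) a *
        ((g : Mat2) 0 1 - (g : Mat2) 0 0 * v)) := by
    funext a
    rw [Function.comp_apply, hD, Function.comp_apply, mul_AdInv, lamBasis_mul, lamBasis_mul]
    simp only [mul_sub, mul_assoc]
  rw [e, quatDet_lamBasis_conj, ha, norm_sub_neg_mul, norm_inv]
  rw [ha, norm_neg, norm_mul, Quaternion.norm_star] at r0
  rw [hdv, norm_mul] at r1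
  have hc : ‖(g : Mat2) 1 0‖ ≠ 0 := norm_ne_zero_iff.2 hg
  have hbc := eq_of_sq_mul_add_sq (norm_nonneg _) (norm_nonneg _) r0 r1
  rw [hbc, inv_mul_cancel_left₀ hc]

lemma map_dProj_AdInv_Lam (g : Sp2) :
    exteriorPower.map 4 (dProj g) (exteriorPower.map 4 (AdInv g) Lam) =
      -rightCoeff (proj g) • frameFour (proj g) := by
  by_cases hg : (g : Mat2) 1 0 = 0
  · exact map_dProj_AdInv_Lam_infty hg
  · exact map_dProj_AdInv_Lam_cell hg

/-! ### Smoothness of four-vector fields and four-forms -/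

/-- `frameFour` switches from the chart v to the chart w at the single point w = 0. The coefficient
`c` therefore carries the factor |w|⁻⁸ for w ≠ 0 and none at w = 0, while `G` is the true
coefficient in the chart w. -/
lemma isSmooth_of_coeff {c : HP1 → ℝ} {F G : ℍ[ℝ] → ℝ} (hF : ContDiff ℝ ∞ F)
    (hG : ContDiff ℝ ∞ G) (h : ∀ v, c (cellPoint v) = F v)
    (h' : ∀ w ≠ 0, c (chartInfty.symm w) = G w * ‖w⁻¹‖ ^ 8) (h0 : c (chartInfty.symm 0) = G 0) :
    FourVectorField.IsSmooth fun x => c x • frameFour x := by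
  rintro e (rfl | rfl)
  · refine ⟨F, hF.contDiffOn, fun y _ => ?_⟩
    change c (cellPoint y) • frameFour (cellPoint y) = F y • pushFour cellPoint y cartesianFour
    rw [pushFour_cellPoint, h]
  · refine ⟨G, hG.contDiffOn, fun y _ => ?_⟩
    rcases eq_or_ne y 0 with rfl | hy
    · change c (chartInfty.symm 0) • frameFour _ = _
      rw [pushFour_chartInfty_symm_zero, h0]
    · change c (chartInfty.symm y) • frameFour _ = _
      rw [pushFour_chartInfty_symm hy, h' y hy, mul_smul]

lemma form_pushFour (ψ : FourForm) (p : ℍ[ℝ] → HP1) (y : ℍ[ℝ]) :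
    (ψ (p y) fun a => (mfderiv 𝓘(ℝ, ℍ[ℝ]) 𝓘(ℝ, ℍ[ℝ]) p y :
      ℍ[ℝ] →L[ℝ] TangentSpace 𝓘(ℝ, ℍ[ℝ]) (p y)) (quatBasis a)) =
    exteriorPower.alternatingMapLinearEquiv (ψ (p y)) (pushFour p y cartesianFour) := by
  exact ((congrArg _ (exteriorPower.map_apply_ιMulti _ _)).trans
    (exteriorPower.alternatingMapLinearEquiv_apply_ιMulti _ _)).symm

/-- The value of a four-form on the frame of the preferred chart. -/
def formCoeff {x : HP1} (φ : (TangentSpace 𝓘(ℝ, ℍ[ℝ]) x) [⋀^Fin 4]→ₗ[ℝ] ℝ) : ℝ :=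
  exteriorPower.alternatingMapLinearEquiv φ (frameFour x)

lemma alternatingMapLinearEquiv_frameFour {x : HP1}
    (φ : (TangentSpace 𝓘(ℝ, ℍ[ℝ]) x) [⋀^Fin 4]→ₗ[ℝ] ℝ) :
    exteriorPower.alternatingMapLinearEquiv φ (frameFour x) = formCoeff φ := rfl

lemma form_ext {x : HP1} {φ φ' : (TangentSpace 𝓘(ℝ, ℍ[ℝ]) x) [⋀^Fin 4]→ₗ[ℝ] ℝ}
    (h : formCoeff φ = formCoeff φ') : φ = φ' := by
  refine exteriorPower.alternatingMapLinearEquiv.injective (LinearMap.ext fun ξ => ?_)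
  obtain ⟨c, rfl⟩ := exists_eq_smul_frameFour ξ
  rw [map_smul, map_smul, alternatingMapLinearEquiv_frameFour,
    alternatingMapLinearEquiv_frameFour, h]

/-! ### The invariant volume form -/

/-- The projection to `HP¹`, at `g`, of the right invariant frame `E, S_i, S_j, S_k`. -/
def rightFrame (g : Sp2) (a : Fin 4) : TangentSpace 𝓘(ℝ, ℍ[ℝ]) (proj g) :=
  dProj g (AdInv g (lamBasis a))

lemma ιMulti_rightFrame (g : Sp2) :
    exteriorPower.ιMulti ℝ 4 (rightFrame g) = -rightCoeff (proj g) • frameFour (proj g) := by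
  rw [← map_dProj_AdInv_Lam, Lam_eq, exteriorPower.map_apply_ιMulti,
    exteriorPower.map_apply_ιMulti]
  rfl

lemma form_rightFrame (g : Sp2)
    (φ : (TangentSpace 𝓘(ℝ, ℍ[ℝ]) (proj g)) [⋀^Fin 4]→ₗ[ℝ] ℝ) :
    φ (rightFrame g) = -rightCoeff (proj g) * formCoeff φ := by
  rw [← exteriorPower.alternatingMapLinearEquiv_apply_ιMulti, ιMulti_rightFrame, map_smul,
    alternatingMapLinearEquiv_frameFour, smul_eq_mul]

lemma mfderiv_act_rightFrame (h g : Sp2) (a : Fin 4) :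
    mfderiv 𝓘(ℝ, ℍ[ℝ]) 𝓘(ℝ, ℍ[ℝ]) (act h) (proj g) (rightFrame g a) = rightFrame (g * h) a := by
  have e := mfderiv_act_dProj h g (AdInv g (lamBasis a))
  rw [AdInv_AdInv] at e
  exact e

lemma pullback_rightFrame (ψ : FourForm) (h g : Sp2) :
    (ψ (act h (proj g))).compLinearMap
      (mfderiv 𝓘(ℝ, ℍ[ℝ]) 𝓘(ℝ, ℍ[ℝ]) (act h) (proj g)).toLinearMap (rightFrame g) =
    ψ (proj (g * h)) (rightFrame (g * h)) := by
  have e : (fun a => mfderiv 𝓘(ℝ, ℍ[ℝ]) 𝓘(ℝ, ℍ[ℝ]) (act h) (proj g) (rightFrame g a)) =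
      rightFrame (g * h) := funext fun a => mfderiv_act_rightFrame h g a
  rw [← e]
  rfl

/-- The projected right frame is a basis, as `rightCoeff` is positive, so one value determines a
four-form. -/
lemma form_ext_rightFrame {g : Sp2}
    {φ φ' : (TangentSpace 𝓘(ℝ, ℍ[ℝ]) (proj g)) [⋀^Fin 4]→ₗ[ℝ] ℝ}
    (h : φ (rightFrame g) = φ' (rightFrame g)) : φ = φ' := by
  rw [form_rightFrame, form_rightFrame] at h
  exact form_ext (mul_left_cancel₀ (neg_ne_zero.2 (rightCoeff_pos _).ne') h)

/-- The invariant volume form, dual to the projection of `-Λᴿ`. -/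
def volForm : FourForm := fun x =>
  (rightCoeff x)⁻¹ • quatDet.compLinearMap (tang x).symm.toLinearEquiv.toLinearMap

lemma formCoeff_volForm (x : HP1) : formCoeff (volForm x) = (rightCoeff x)⁻¹ := by
  have h : formCoeff (volForm x) = (rightCoeff x)⁻¹ *
      quatDet (fun a => (tang x).symm (tang x (quatBasis a))) := by
    rw [formCoeff, frameFour, cartesianFour, exteriorPower.map_apply_ιMulti,
      exteriorPower.alternatingMapLinearEquiv_apply_ιMulti]
    rfl
  simp only [ContinuousLinearEquiv.symm_apply_apply] at h
  rw [h, quatDet_quatBasis, mul_one]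

lemma rightCoeff_cellPoint (v : ℍ[ℝ]) : rightCoeff (cellPoint v) = (1 + ‖v‖ ^ 2) ^ 4 := by
  rw [rightCoeff, if_pos (cellPoint_mem v), cellCoord_cellPoint]

lemma rightCoeff_chartInfty_symm {w : ℍ[ℝ]} (hw : w ≠ 0) :
    rightCoeff (chartInfty.symm w) = (1 + ‖w‖ ^ 2) ^ 4 * ‖w⁻¹‖ ^ 8 := by
  rw [rightCoeff, if_pos (chartInfty_symm_mem_cell.2 hw), cellCoord_chartInfty_symm hw, norm_inv]
  have := norm_ne_zero_iff.2 hw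
  field_simp
  ring

lemma rightCoeff_chartInfty_symm_zero : rightCoeff (chartInfty.symm 0) = 1 :=
  if_neg fun h => chartInfty_symm_mem_cell.1 h rfl

lemma contDiff_one_add_sq_norm : ContDiff ℝ ∞ fun v : ℍ[ℝ] => 1 + ‖v‖ ^ 2 :=
  contDiff_const.add (contDiff_norm_sq ℝ)

lemma isSmooth_volForm : volForm.IsSmooth := by
  have hs : ContDiffOn ℝ ∞ (fun v : ℍ[ℝ] => ((1 + ‖v‖ ^ 2) ^ 4)⁻¹) Set.univ := by
    refine (ContDiff.inv (contDiff_one_add_sq_norm.pow 4) fun v => ?_).contDiffOn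
    positivity
  rintro e (rfl | rfl)
  · refine hs.congr fun v _ => (form_pushFour volForm _ v).trans ?_
    change exteriorPower.alternatingMapLinearEquiv (volForm (cellPoint v))
      (pushFour cellPoint v cartesianFour) = _
    rw [pushFour_cellPoint, alternatingMapLinearEquiv_frameFour, formCoeff_volForm,
      rightCoeff_cellPoint]
  · refine hs.congr fun w _ => (form_pushFour volForm _ w).trans ?_
    rcases eq_or_ne w 0 with rfl | hw
    · rw [pushFour_chartInfty_symm_zero, alternatingMapLinearEquiv_frameFour, formCoeff_volForm,
        rightCoeff_chartInfty_symm_zero]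
      simp
    · have h8 : ‖w⁻¹‖ ^ 8 ≠ 0 := pow_ne_zero _ (norm_ne_zero_iff.2 (inv_ne_zero hw))
      rw [pushFour_chartInfty_symm hw, map_smul, alternatingMapLinearEquiv_frameFour,
        formCoeff_volForm, rightCoeff_chartInfty_symm hw, smul_eq_mul, mul_inv, mul_comm,
        inv_mul_cancel_right₀ h8]

lemma isInvariantVolumeForm_volForm : IsInvariantVolumeForm volForm where
  smooth := isSmooth_volForm
  ne_zero x h := by
    have h1 := formCoeff_volForm x
    rw [h, formCoeff, map_zero, LinearMap.zero_apply] at h1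
    exact inv_ne_zero (rightCoeff_pos x).ne' h1.symm
  -- On the right frame, which the action preserves, `volForm` has the constant value -1.
  invariant h x := by
    obtain ⟨g, rfl⟩ := proj_surjective x
    refine form_ext_rightFrame ?_
    rw [pullback_rightFrame, form_rightFrame, form_rightFrame, formCoeff_volForm,
      formCoeff_volForm, neg_mul, neg_mul, mul_inv_cancel₀ (rightCoeff_pos _).ne',
      mul_inv_cancel₀ (rightCoeff_pos _).ne']

/-! ### The invariant quatrisson structures -/

/-- The projection of `-Λᴿ`, an invariant quatrisson structure. -/
def invariantField : FourVectorField := fun x => rightCoeff x • frameFour x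

lemma isInvariantQuatrisson_invariantField : IsInvariantQuatrisson invariantField := by
  refine ⟨isSmooth_of_coeff (contDiff_one_add_sq_norm.pow 4) (contDiff_one_add_sq_norm.pow 4)
    rightCoeff_cellPoint (fun w hw => rightCoeff_chartInfty_symm hw) ?_,
    volForm, isInvariantVolumeForm_volForm, fun x => ?_⟩
  · rw [rightCoeff_chartInfty_symm_zero]
    simp
  · rw [invariantField, map_smul, alternatingMapLinearEquiv_frameFour, formCoeff_volForm,
      smul_eq_mul, mul_inv_cancel₀ (rightCoeff_pos x).ne']

/-- Invariance transports the value K of ψ on the right frame from the base point to every point.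
This fixes ψ, and i_χ ψ = 1 then fixes χ. -/
lemma IsInvariantQuatrisson.eq_smul {χ : FourVectorField} (h : IsInvariantQuatrisson χ) :
    ∃ k : ℝ, k ≠ 0 ∧ χ = k • invariantField := by
  obtain ⟨-, ψ, hψ, h1⟩ := h
  set K := ψ (proj 1) (rightFrame 1) with hK
  have hψK : ∀ g : Sp2, -rightCoeff (proj g) * formCoeff (ψ (proj g)) = K := by
    intro g
    have e := pullback_rightFrame ψ g 1
    rw [hψ.invariant, one_mul, form_rightFrame g] at e
    exact e.symm
  have hc : ∀ g : Sp2, ∃ c : ℝ, χ (proj g) = c • frameFour (proj g) ∧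
      c * formCoeff (ψ (proj g)) = 1 := by
    intro g
    obtain ⟨c, hc⟩ := exists_eq_smul_frameFour (χ (proj g))
    refine ⟨c, hc, ?_⟩
    have h2 := h1 (proj g)
    rwa [hc, map_smul, alternatingMapLinearEquiv_frameFour, smul_eq_mul] at h2
  have hK0 : K ≠ 0 := by
    obtain ⟨c, -, h2⟩ := hc 1
    rw [← hψK 1]
    exact mul_ne_zero (neg_ne_zero.2 (rightCoeff_pos _).ne') (right_ne_zero_of_mul_eq_one h2)
  -- With f the coefficient of ψ and r that of the invariant field, -rf = K and cf = 1 give c =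
  -- -r/K.
  refine ⟨-K⁻¹, neg_ne_zero.2 (inv_ne_zero hK0), ?_⟩
  funext x
  obtain ⟨g, rfl⟩ := proj_surjective x
  obtain ⟨c, hcg, h2⟩ := hc g
  rw [hcg, Pi.smul_apply, invariantField, smul_smul]
  congr 1
  have h3 := hψK g
  field_simp
  linear_combination (-c) * h3 - rightCoeff (proj g) * h2

lemma frameFour_ne_zero (x : HP1) : frameFour x ≠ 0 := by
  intro h
  have h1 := formCoeff_volForm x
  rw [formCoeff, h, map_zero] at h1
  exact inv_ne_zero (rightCoeff_pos x).ne' h1.symm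

lemma invariantField_cellPoint_zero :
    invariantField (cellPoint 0) = pushFour cellPoint 0 cartesianFour := by
  rw [invariantField, rightCoeff_cellPoint, pushFour_cellPoint]
  simp

lemma IsInvariantQuatrisson.eq_invariantField {χ : FourVectorField} (h : IsInvariantQuatrisson χ)
    (h0 : χ (cellPoint 0) = pushFour cellPoint 0 cartesianFour) : χ = invariantField := by
  obtain ⟨k, -, rfl⟩ := h.eq_smul
  rw [Pi.smul_apply, invariantField_cellPoint_zero, pushFour_cellPoint] at h0
  have hk : k = 1 := smul_left_injective ℝ (frameFour_ne_zero (cellPoint 0))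
    (h0.trans (one_smul ℝ _).symm)
  rw [hk, one_smul]

/-! ### The Bruhat quatrisson structure -/

/-- The projection of `Λᴸ - Λᴿ`. -/
def bruhatField : FourVectorField := fun x => (leftCoeff x + rightCoeff x) • frameFour x

lemma bruhatField_proj (g : Sp2) :
    bruhatField (proj g) = exteriorPower.map 4 (dProj g) (sham g) := by
  rw [sham, map_sub, map_dProj_Lam, map_dProj_AdInv_Lam, bruhatField]
  module

lemma bruhatCoeff_cellPoint (v : ℍ[ℝ]) : leftCoeff (cellPoint v) + rightCoeff (cellPoint v) =
    2 * ((1 + ‖v‖ ^ 2) * (1 + 3 * ‖v‖ ^ 4)) := by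
  rw [rightCoeff_cellPoint, leftCoeff, if_pos (cellPoint_mem v), cellCoord_cellPoint]
  ring

lemma isBruhatQuatrisson_bruhatField : IsBruhatQuatrisson bruhatField := by
  have h2 : ContDiff ℝ ∞ fun v : ℍ[ℝ] => ‖v‖ ^ 2 := contDiff_norm_sq ℝ
  -- `G` is |w|⁸ times the coefficient at v = w⁻¹: with s = |w|², (1 + s)((s - 1)³ + (s + 1)³) =
  -- 2s(1 + s)(3 + s²). Fourth powers are written as squares of |·|², the norm itself not being
  -- smooth at 0.
  refine ⟨isSmooth_of_coeff (F := fun v => 2 * ((1 + ‖v‖ ^ 2) * (1 + 3 * (‖v‖ ^ 2) ^ 2)))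
    (G := fun w => 2 * (‖w‖ ^ 2 * ((1 + ‖w‖ ^ 2) * (3 + (‖w‖ ^ 2) ^ 2)))) (by fun_prop)
    (by fun_prop) (fun v => ?_) (fun w hw => ?_) ?_, bruhatField_proj⟩
  · rw [bruhatCoeff_cellPoint]
    ring
  · rw [rightCoeff, leftCoeff, if_pos (chartInfty_symm_mem_cell.2 hw),
      if_pos (chartInfty_symm_mem_cell.2 hw), cellCoord_chartInfty_symm hw, norm_inv]
    have := norm_ne_zero_iff.2 hw
    field_simp
    ring
  -- At the point outside the cell the two contributions -1 and 1 cancel: the Bruhat field vanishes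
  -- there.
  · rw [rightCoeff_chartInfty_symm_zero, leftCoeff,
      if_neg fun h => chartInfty_symm_mem_cell.1 h rfl]
    simp

lemma IsBruhatQuatrisson.eq_bruhatField {β : FourVectorField} (h : IsBruhatQuatrisson β) :
    β = bruhatField := by
  funext x
  obtain ⟨g, rfl⟩ := proj_surjective x
  rw [h.2, bruhatField_proj]

lemma pushFour_radialTheta {v : ℍ[ℝ]} (hv : v ≠ 0) :
    pushFour cellPoint v (radialTheta v) = ‖v‖ ^ 3 • frameFour (cellPoint v) := by
  rw [radialTheta_eq hv, map_smul, pushFour_cellPoint]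

/-! ### Polar coordinates -/

lemma norm_quatBasis (a : Fin 4) : ‖quatBasis a‖ = 1 := by
  rw [← sq_eq_sq₀ (norm_nonneg _) zero_le_one, sq_norm_eq]
  fin_cases a <;> simp [quatBasis_components]

lemma exp_smul_quatBasis (t : ℝ) {a : Fin 4} (ha : a ≠ 0) :
    NormedSpace.exp (t • quatBasis a) = (Real.cos t : ℍ[ℝ]) + Real.sin t • quatBasis a := by
  have h : (t • quatBasis a).re = 0 := by
    rw [Quaternion.re_smul, (quatBasis_components a).1]
    fin_cases a <;> simp at ha ⊢
  rw [Quaternion.exp_of_re_eq_zero _ h, norm_smul, norm_quatBasis, mul_one, Real.norm_eq_abs,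
    Real.cos_abs, smul_smul]
  congr 2
  -- The exponential formula supplies (sin|t|/|t|)·t, which is sin t because sin is odd; at t = 0
  -- the quotient is 0/0 = 0 and both sides vanish.
  rcases abs_cases t with ⟨ht, -⟩ | ⟨ht, -⟩ <;> rw [ht]
  · rcases eq_or_ne t 0 with rfl | h0
    · simp
    · field_simp
  · rcases eq_or_ne t 0 with rfl | h0
    · simp
    · rw [Real.sin_neg]
      field_simp

lemma norm_exp_smul_quatBasis (t : ℝ) {a : Fin 4} (ha : a ≠ 0) :
    ‖NormedSpace.exp (t • quatBasis a)‖ = 1 := by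
  have h : (t • quatBasis a).re = 0 := by
    rw [Quaternion.re_smul, (quatBasis_components a).1]
    fin_cases a <;> simp at ha ⊢
  rw [Quaternion.norm_exp, h, NormedSpace.exp_zero, norm_one]

/-- Conjugation by exp(θj) turns i by the angle 2θ in the plane of i and k, to cos(2θ) i + sin(2θ)
k; the k part drops out against the last vector. -/
lemma quatDet_polar (ρ θ : ℝ) :
    quatDet ![1, ρ • (star (NormedSpace.exp (θ • quatBasis 2)) *
      (quatBasis 1 * NormedSpace.exp (θ • quatBasis 2))), ρ • quatBasis 2, ρ • quatBasis 3] =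
      Real.cos (2 * θ) * ρ ^ 3 := by
  rw [exp_smul_quatBasis θ (by decide), quatDet_apply, Real.cos_two_mul']
  simp [quatBasis_components, Matrix.det_succ_row_zero, Fin.sum_univ_succ, Fin.succAbove]
  ring

lemma norm_polar {ρ : ℝ} (hρ : 0 < ρ) (θ₁ θ₂ θ₃ : ℝ) : ‖polar ρ θ₁ θ₂ θ₃‖ = ρ := by
  rw [polar, norm_smul, norm_mul, norm_mul, norm_exp_smul_quatBasis _ (by decide),
    norm_exp_smul_quatBasis _ (by decide), norm_exp_smul_quatBasis _ (by decide),
    Real.norm_of_nonneg hρ.le]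
  ring

lemma polarFour_eq {ρ : ℝ} (hρ : 0 < ρ) (θ₁ θ₂ θ₃ : ℝ) :
    polarFour ρ θ₁ θ₂ θ₃ = Real.cos (2 * θ₂) • radialTheta (polar ρ θ₁ θ₂ θ₃) := by
  have hn := norm_polar hρ θ₁ θ₂ θ₃
  have h0 : polar ρ θ₁ θ₂ θ₃ ≠ 0 := norm_ne_zero_iff.1 (hn.trans_ne hρ.ne')
  rw [radialTheta_eq h0, hn, polarFour, ιMulti_eq_quatDet_smul, smul_smul]
  congr 1
  rw [← quatDet_polar]
  have n1 := norm_exp_smul_quatBasis θ₁ (a := 1) (by decide)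
  have n2 := norm_exp_smul_quatBasis θ₂ (a := 2) (by decide)
  have n3 := norm_exp_smul_quatBasis θ₃ (a := 3) (by decide)
  have d1 := hasDerivAt_exp_smul_const (𝕂 := ℝ) (quatBasis 1) θ₁
  have d2 := hasDerivAt_exp_smul_const (𝕂 := ℝ) (quatBasis 2) θ₂
  have d3 := hasDerivAt_exp_smul_const' (𝕂 := ℝ) (quatBasis 3) θ₃
  have hd0 : HasDerivAt (fun t => polar t θ₁ θ₂ θ₃) _ ρ := (hasDerivAt_id ρ).smul_const _
  have hd1 : HasDerivAt (fun t => polar ρ t θ₂ θ₃) _ θ₁ :=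
    ((d1.mul_const _).mul_const _).const_smul ρ
  have hd2 : HasDerivAt (fun t => polar ρ θ₁ t θ₃) _ θ₂ :=
    ((d2.const_mul _).mul_const _).const_smul ρ
  have hd3 : HasDerivAt (fun t => polar ρ θ₁ θ₂ t) _ θ₃ := (d3.const_mul _).const_smul ρ
  rw [hd0.deriv, hd1.deriv, hd2.deriv, hd3.deriv]
  set e₁ := NormedSpace.exp (θ₁ • quatBasis 1)
  set e₂ := NormedSpace.exp (θ₂ • quatBasis 2)
  set e₃ := NormedSpace.exp (θ₃ • quatBasis 3)
  have hs : ∀ q : ℍ[ℝ], e₂ * (star e₂ * q) = q := by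
    intro q
    rw [← mul_assoc, Quaternion.self_mul_star, Quaternion.normSq_eq_norm_mul_self, n2, mul_one,
      Quaternion.coe_one, one_mul]
  -- All four partial derivatives are e₁e₂ · w a · e₃, and the unit factors outside do not change
  -- `quatDet`. Only ∂_θ₁ has to be rearranged, as e₁ i e₂ = e₁e₂(ē₂ i e₂).
  set w : Fin 4 → ℍ[ℝ] := ![1, ρ • (star e₂ * (quatBasis 1 * e₂)), ρ • quatBasis 2,
    ρ • quatBasis 3]
  have e : ∀ f : Fin 4 → ℍ[ℝ], (∀ a, f a = (e₁ * e₂) * (w a * e₃)) → quatDet f = quatDet w := by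
    intro f hf
    rw [funext hf, quatDet_mul_left, quatDet_mul_right, norm_mul, n1, n2, n3]
    ring
  refine e _ fun a => ?_
  fin_cases a <;> simp [w, mul_assoc, hs]

end Quatrisson

end

theorem mainTheorem5 :
    (∃! χ : FourVectorField, IsInvariantQuatrisson χ ∧
      χ (cellPoint 0) = pushFour cellPoint 0 cartesianFour) ∧
    (∀ χ χ' : FourVectorField, IsInvariantQuatrisson χ → IsInvariantQuatrisson χ' →
      ∃ c : ℝ, c ≠ 0 ∧ χ' = c • χ) ∧
    (∃! β : FourVectorField, IsBruhatQuatrisson β) ∧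
    (∀ β : FourVectorField, IsBruhatQuatrisson β →
      β (cellPoint 0) = (2 : ℝ) • pushFour cellPoint 0 cartesianFour) ∧
    (∀ χ β aleph : FourVectorField,
      IsInvariantQuatrisson χ → χ (cellPoint 0) = pushFour cellPoint 0 cartesianFour →
      IsBruhatQuatrisson β → aleph = (1 / 2 : ℝ) • β →
      (∀ v : ℍ[ℝ], v ≠ 0 →
        χ (cellPoint v) =
          ((1 + ‖v‖ ^ 2) ^ 4 / ‖v‖ ^ 3) • pushFour cellPoint v (radialTheta v)) ∧
      (∀ v : ℍ[ℝ], v ≠ 0 →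
        aleph (cellPoint v) =
          ((1 + ‖v‖ ^ 2) * (1 + 3 * ‖v‖ ^ 4) / ‖v‖ ^ 3) •
            pushFour cellPoint v (radialTheta v)) ∧
      (∀ v : ℍ[ℝ],
        aleph (cellPoint v) =
          ((1 + 3 * ‖v‖ ^ 4) / (1 + ‖v‖ ^ 2) ^ 3) • χ (cellPoint v))) ∧
    (∀ ρ θ₁ θ₂ θ₃ : ℝ, 0 < ρ →
      polarFour ρ θ₁ θ₂ θ₃ = Real.cos (2 * θ₂) • radialTheta (polar ρ θ₁ θ₂ θ₃)) := by
  refine ⟨⟨invariantField, ⟨isInvariantQuatrisson_invariantField, invariantField_cellPoint_zero⟩,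
    fun χ h => h.1.eq_invariantField h.2⟩, ?_, ⟨bruhatField, isBruhatQuatrisson_bruhatField,
    fun β h => h.eq_bruhatField⟩, ?_, ?_, fun ρ θ₁ θ₂ θ₃ hρ => polarFour_eq hρ θ₁ θ₂ θ₃⟩
  · intro χ χ' h h'
    obtain ⟨k, hk, rfl⟩ := h.eq_smul
    obtain ⟨k', hk', rfl⟩ := h'.eq_smul
    exact ⟨k' / k, div_ne_zero hk' hk, by rw [smul_smul, div_mul_cancel₀ _ hk]⟩
  · intro β h
    rw [h.eq_bruhatField, bruhatField, bruhatCoeff_cellPoint, pushFour_cellPoint]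
    simp
  · intro χ β aleph hχ hχ0 hβ haleph
    have hA : ∀ v, aleph (cellPoint v) =
        ((1 + ‖v‖ ^ 2) * (1 + 3 * ‖v‖ ^ 4)) • frameFour (cellPoint v) := by
      intro v
      rw [haleph, hβ.eq_bruhatField, Pi.smul_apply, bruhatField, bruhatCoeff_cellPoint, smul_smul]
      congr 1
      ring
    have hX : ∀ v, χ (cellPoint v) = ((1 + ‖v‖ ^ 2) ^ 4) • frameFour (cellPoint v) := by
      intro v
      rw [hχ.eq_invariantField hχ0, invariantField, rightCoeff_cellPoint]
    refine ⟨fun v hv => ?_, fun v hv => ?_, fun v => ?_⟩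
    · have := norm_ne_zero_iff.2 hv
      rw [hX, pushFour_radialTheta hv, smul_smul, div_mul_cancel₀ _ (pow_ne_zero 3 this)]
    · have := norm_ne_zero_iff.2 hv
      rw [hA, pushFour_radialTheta hv, smul_smul, div_mul_cancel₀ _ (pow_ne_zero 3 this)]
    · rw [hA, hX, smul_smul]
      congr 1
      have : 1 + ‖v‖ ^ 2 ≠ 0 := by positivity
      field_simp
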